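/- **Setting.** A datalog program $\Pi$ is a finite set of safe positive rules $q(\bar s)\leftarrow p_1(\bar s_1),\dots,p_\mu(\bar s_\mu)$ whose arguments are variables or constants (safe: each head variable occurs in the body). A predicate is an IDB predicate if it is the head predicate of a rule with non-empty body, otherwise an EDB predicate; all head predicates of $\Pi$ are IDB predicates. An EDB is a set $D$ of facts over EDB predicates, and $[\![q(\Pi,D)]\!]$ is the relation $q$ in the least fixpoint of the immediate consequence operator of $\Pi$ started with $D$. An *EDB-adorned atom* $q_\rho(\bar t)$ consists of an IDB atom $q(\bar t)$ and an *adornment* $\rho$, a safe rule with head predicate $q$ whose body is a finite set of EDB atoms with arguments that are variables or the wildcard "$\_$" (each occurrence being its own existentially quantified variable), such that $q(\bar t)$ is an instance of the head of $\rho$. Adornments that agree up to renaming of variables give the same predicate $q_\rho$. An *EDB-adorned program* is a program in which all head atoms are EDB-adorned atoms and all body atoms are EDB atoms or EDB-adorned atoms. It is *EDB-bounded* if for each rule $R$, with head predicate $q_\rho$ say, and each EDB $D$: whenever $q_\rho(\bar t)$ is derived by a derivation over $D$ whose last step applies $R$, then $q(\bar t)$ is derived by the single rule $\rho$ over $D$.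 **Algorithm.** Start with $\Pi'=\emptyset$ and repeat the following until no rule can be added. Choose a rule $R: q(\bar s)\leftarrow p_1(\bar s_1),\dots,p_\lambda(\bar s_\lambda),\mathcal E$ of $\Pi$, where the $p_i(\bar s_i)$ are its IDB atoms and $\mathcal E$ its EDB atoms, and for each $i\le\lambda$ a rule of $\Pi'$ with head ${p_i}_{\rho_i}(\bar v_i)$, where $\rho_i$ has head $p_i(\bar v_i)$. Rename the variables of these heads, together with their adornments, so that they are pairwise variable-disjoint and disjoint from $R$; this gives ${p_i}_{\rho_i'}(\bar v_i')$ with $\rho_i': p_i(\bar v_i')\leftarrow\mathcal B_i$. If there is a most general simultaneous unifier of the pairs $(\bar s_i,\bar v_i')$, take any such $\sigma$, and let $$\rho_0:\ q(\sigma(\bar s))\leftarrow \sigma(\mathcal B_1),\dots,\sigma(\mathcal B_\lambda),\sigma(\mathcal E),\qquad \rho:=g_{\sf out}(\rho_0),$$ $$R':\ q_\rho(\sigma(\bar s))\leftarrow {p_1}_{\rho_1}(\sigma(\bar s_1)),\dots,{p_\lambda}_{\rho_\lambda}(\sigma(\bar s_\lambda)),\sigma(\mathcal E).$$ Add $R'$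 to $\Pi'$ unless the check $h_{\sf eq}$ is true, that is, unless $\Pi'$ contains a rule identical to $R'$ up to renaming of variables. Here $g_{\sf out}$ replaces every argument of a body atom that is not a variable of the head by "$\_$", and then removes every body atom that has only wildcards as arguments and every body atom $e(\bar t)$ for which there is another body atom $e(\bar t')$ with $t_j=t'_j$ or $t_j=\_$ for all $j$. **Theorem.** Let $\Pi$ be any datalog program. The algorithm terminates on $\Pi$, for every order of the additions and all choices of renamings and most general unifiers (so it has an output), and each of its outputs $\Pi'$ is an EDB-bounded program that is equivalent to $\Pi$: for every EDB $D$ and every IDB predicate $q$ of $\Pi$, $$[\![q(\Pi,D)]\!]=\bigcup_\rho\,[\![q_\rho(\Pi',D)]\!].$$ -/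

import Mathlib

namespace Datalog

/-! ### Syntax of datalog. Variables are natural numbers; `ar p` is the arity of the predicate `p`;
`C` is the domain of constants. -/

/-- A term is a variable or a constant. -/
inductive Term (C : Type*) where
  | var (x : ℕ) : Term C
  | const (c : C) : Term C

/-- A substitution is a map from variables to terms. -/
abbrev Subst (C : Type*) := ℕ → Term C

/-- Application of a substitution to a term. -/
def Term.subst {C : Type*} (σ : Subst C) : Term C → Term C
  | .var x => σ x
  | .const c => .const c

/-- The value of a term under a ground substitution. -/
def Term.ground {C : Type*} (ν : ℕ → C) : Term C → C
  | .var x => ν x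
  | .const c => c

/-- A term or the wildcard `_`, which is `none`. -/
abbrev WTerm (C : Type*) := Option (Term C)

/-- An atom `p(t₁, …, tₙ)`, `n = ar p`, whose arguments are taken from `T`. -/
@[ext]
structure Atom {P : Type*} (ar : P → ℕ) (T : Type*) where
  pred : P
  args : Fin (ar pred) → T

/-- Application of a function to all arguments of an atom. -/
def Atom.map {P T T' : Type*} {ar : P → ℕ} (f : T → T') (A : Atom ar T) : Atom ar T' :=
  ⟨A.pred, fun j => f (A.args j)⟩

/-- A fact is a ground atom. -/
abbrev Fact {P : Type*} (ar : P → ℕ) (C : Type*) := Atom ar C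

/-- A datalog rule `head ← body`. -/
@[ext]
structure Rule {P : Type*} (ar : P → ℕ) (C : Type*) where
  head : Atom ar (Term C)
  body : List (Atom ar (Term C))

section RuleSyn

variable {P C : Type*} {ar : P → ℕ}

/-- The variables of an atom without wildcards. -/
def Atom.vars (A : Atom ar (Term C)) : Set ℕ := {x | ∃ j, A.args j = .var x}

/-- The variables of an atom with wildcards. -/
def Atom.wvars (A : Atom ar (WTerm C)) : Set ℕ := {x | ∃ j, A.args j = some (.var x)}

/-- The variables of a rule. -/
def Rule.vars (R : Rule ar C) : Set ℕ := R.head.vars ∪ {x | ∃ B ∈ R.body, x ∈ B.vars}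

/-- A rule is safe if every variable of the head occurs in the body. -/
def Rule.Safe (R : Rule ar C) : Prop := ∀ x ∈ R.head.vars, ∃ B ∈ R.body, x ∈ B.vars

/-- Application of a substitution to a rule. -/
def Rule.subst (σ : Subst C) (R : Rule ar C) : Rule ar C :=
  ⟨R.head.map (Term.subst σ), R.body.map (Atom.map (Term.subst σ))⟩

/-- Renaming of variables in a rule. -/
def Rule.rename (π : Equiv.Perm ℕ) (R : Rule ar C) : Rule ar C :=
  R.subst fun x => .var (π x)

/-- The IDB predicates of a program: those in the head of a rule with a non-empty body.
All other predicates are EDB predicates. -/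
def idb (Pg : Set (Rule ar C)) : Set P := {p | ∃ R ∈ Pg, R.body ≠ [] ∧ R.head.pred = p}

/-- A (positive) datalog program is a finite set of safe rules. The facts of the EDB relations
belong to the database, not to the program: the head predicate of each rule is an IDB predicate. -/
structure IsProgram (Pg : Set (Rule ar C)) : Prop where
  finite : Pg.Finite
  safe : ∀ R ∈ Pg, R.Safe
  head_idb : ∀ R ∈ Pg, R.head.pred ∈ idb Pg

end RuleSyn

/-! ### Semantics of datalog -/

section Semantics

variable {P C : Type*} {ar : P → ℕ}

/-- The rule `R` fires on the set `I` of facts with the ground substitution `ν`. -/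
def Rule.Fires (R : Rule ar C) (I : Set (Fact ar C)) (ν : ℕ → C) : Prop :=
  ∀ B ∈ R.body, B.map (Term.ground ν) ∈ I

/-- The facts obtained by applying the rule `R` once to the set `I` of facts. -/
def Rule.apply (R : Rule ar C) (I : Set (Fact ar C)) : Set (Fact ar C) :=
  {F | ∃ ν : ℕ → C, R.Fires I ν ∧ R.head.map (Term.ground ν) = F}

/-- The immediate consequence operator of a program, started with the database `D`. -/
def consequence (Pg : Set (Rule ar C)) (D : Set (Fact ar C)) :
    Set (Fact ar C) →o Set (Fact ar C) where
  toFun I := D ∪ {F | ∃ R ∈ Pg, F ∈ R.apply I}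
  monotone' := by
    rintro I J hIJ F (hF | ⟨R, hR, ν, hν, rfl⟩)
    · exact Or.inl hF
    · exact Or.inr ⟨R, hR, ν, fun B hB => hIJ (hν B hB), rfl⟩

/-- All facts derived by the program from `D`: the least fixpoint of the immediate consequence
operator. -/
def derived (Pg : Set (Rule ar C)) (D : Set (Fact ar C)) : Set (Fact ar C) :=
  OrderHom.lfp (consequence Pg D)

/-- The relation of the predicate `q` computed by the program from `D`. -/
def relation (Pg : Set (Rule ar C)) (D : Set (Fact ar C)) (q : P) : Set (Fin (ar q) → C) :=
  {t | (⟨q, t⟩ : Fact ar C) ∈ derived Pg D}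

/-- The facts derived by the rule `R` when the program is evaluated over `D`, that is, the facts
with a derivation whose last step applies `R`. -/
def derivedBy (Pg : Set (Rule ar C)) (D : Set (Fact ar C)) (R : Rule ar C) : Set (Fact ar C) :=
  R.apply (derived Pg D)

end Semantics

/-! ### Adornments -/

/-- An adornment `head ← body`: a rule whose body is a finite set of atoms with wildcards. -/
@[ext]
structure Adornment {P : Type*} (ar : P → ℕ) (C : Type*) where
  head : Atom ar (Term C)
  body : Finset (Atom ar (WTerm C))

section Adornments

variable {P C : Type*} {ar : P → ℕ}

/-- The variables of an adornment. -/
def Adornment.vars (ρ : Adornment ar C) : Set ℕ :=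
  ρ.head.vars ∪ {x | ∃ B ∈ ρ.body, x ∈ B.wvars}

open Classical in
/-- Application of a substitution to an adornment; wildcards are not changed. -/
noncomputable def Adornment.subst (σ : Subst C) (ρ : Adornment ar C) : Adornment ar C :=
  ⟨ρ.head.map (Term.subst σ), ρ.body.image (Atom.map (Option.map (Term.subst σ)))⟩

/-- Renaming of variables in an adornment. -/
noncomputable def Adornment.rename (π : Equiv.Perm ℕ) (ρ : Adornment ar C) : Adornment ar C :=
  ρ.subst fun x => .var (π x)

theorem Term.subst_var (t : Term C) : t.subst (fun x => .var x) = t := by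
  cases t <;> rfl

theorem Term.subst_subst (σ τ : Subst C) (t : Term C) :
    (t.subst σ).subst τ = t.subst (fun x => (σ x).subst τ) := by
  cases t <;> rfl

theorem Adornment.rename_one (ρ : Adornment ar C) : ρ.rename 1 = ρ := by
  have h : Term.subst (fun x => .var ((1 : Equiv.Perm ℕ) x)) = (id : Term C → Term C) :=
    funext Term.subst_var
  classical
  unfold Adornment.rename Adornment.subst
  rw [h, Option.map_id]
  ext1
  · rfl
  · exact Finset.image_id

theorem Adornment.rename_mul (π π' : Equiv.Perm ℕ) (ρ : Adornment ar C) :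
    ρ.rename (π' * π) = (ρ.rename π).rename π' := by
  classical
  have h : Term.subst (fun x => .var ((π' * π) x)) =
      (Term.subst (fun x => .var (π' x)) ∘ Term.subst (fun x => .var (π x)) :
        Term C → Term C) := by
    funext t
    cases t <;> rfl
  unfold Adornment.rename Adornment.subst
  rw [h]
  ext1
  · rfl
  · simp only
    rw [Finset.image_image]
    congr 1
    funext B
    simp [Atom.map, Function.comp_def]

/-- Two adornments are variants if they are identical up to renaming of variables. -/
instance Adornment.variant (ar : P → ℕ) (C : Type*) : Setoid (Adornment ar C) where
  r ρ ρ' := ∃ π : Equiv.Perm ℕ, ρ.rename π = ρ'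
  iseqv :=
    { refl := fun ρ => ⟨1, ρ.rename_one⟩
      symm := by
        rintro ρ _ ⟨π, rfl⟩
        exact ⟨π⁻¹, by rw [← Adornment.rename_mul, inv_mul_cancel, Adornment.rename_one]⟩
      trans := by
        rintro ρ _ _ ⟨π, rfl⟩ ⟨π', rfl⟩
        exact ⟨π' * π, Adornment.rename_mul π π' ρ⟩ }

/-- Adornments up to renaming of variables. -/
abbrev AdornmentClass (ar : P → ℕ) (C : Type*) := Quotient (Adornment.variant ar C)

/-- The conditions on an adornment: it is a safe rule, and the body atoms have EDB predicates and
arguments that are variables or wildcards. The set `I` consists of the IDB predicates. -/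
structure Adornment.WellFormed (I : Set P) (ρ : Adornment ar C) : Prop where
  safe : ∀ x ∈ ρ.head.vars, ∃ B ∈ ρ.body, x ∈ B.wvars
  edb : ∀ B ∈ ρ.body, B.pred ∉ I
  var_or_wild : ∀ B ∈ ρ.body, ∀ j, B.args j = none ∨ ∃ x, B.args j = some (.var x)

/-- The facts derived by the single-rule program that consists of the adornment. The body has EDB
predicates only, so a single application of the rule suffices. Each wildcard is an existentially
quantified variable of its own. -/
def Adornment.eval (ρ : Adornment ar C) (D : Set (Fact ar C)) : Set (Fact ar C) :=
  {F | ∃ ν : ℕ → C,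
    (∀ B ∈ ρ.body, ∃ v : Fin (ar B.pred) → C, (⟨B.pred, v⟩ : Fact ar C) ∈ D ∧
      ∀ j, ∀ t : Term C, B.args j = some t → t.ground ν = v j) ∧
    ρ.head.map (Term.ground ν) = F}

end Adornments

/-! ### Adorned programs -/

/-- The predicates of adorned programs: EDB predicates `e` and adorned IDB predicates `q_ρ`.
Renaming the variables of `ρ` does not change the predicate `q_ρ`. -/
inductive AdPred {P : Type*} (ar : P → ℕ) (C : Type*) where
  | edb (e : P) : AdPred ar C
  | idb (q : P) (c : AdornmentClass ar C) : AdPred ar C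

/-- The arity of a predicate of an adorned program. -/
def adAr {P : Type*} (ar : P → ℕ) (C : Type*) : AdPred ar C → ℕ
  | .edb e => ar e
  | .idb q _ => ar q

/-- A rule of an adorned program. -/
abbrev AdRule {P : Type*} (ar : P → ℕ) (C : Type*) := Rule (adAr ar C) C

section Adorned

variable {P C T : Type*} {ar : P → ℕ}

/-- The atom `e(t)` as an EDB atom of an adorned program. -/
def Atom.unadorned (C : Type*) (A : Atom ar T) : Atom (adAr ar C) T :=
  ⟨.edb A.pred, A.args⟩

/-- The adorned atom `q_ρ(t)` made from `q(t)`. -/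
def Atom.adorn (A : Atom ar T) (c : AdornmentClass ar C) : Atom (adAr ar C) T :=
  ⟨.idb A.pred c, A.args⟩

/-- The database `D`, read as a database for adorned programs. -/
def adDatabase (D : Set (Fact ar C)) : Set (Fact (adAr ar C) C) :=
  {F | ∃ G ∈ D, F = G.unadorned C}

/-- A database over the EDB predicates. -/
def IsEDB (I : Set P) (D : Set (Fact ar C)) : Prop := ∀ F ∈ D, F.pred ∉ I

/-- An EDB-adorned atom `q_ρ(t)`: `q` is an IDB predicate, `ρ` is a well-formed adornment, and
`q(t)` is an instance of the head of `ρ`. -/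
def IsAdornedAtom (I : Set P) (A : Atom (adAr ar C) (Term C)) : Prop :=
  ∃ (B : Atom ar (Term C)) (ρ : Adornment ar C), A = B.adorn ⟦ρ⟧ ∧ B.pred ∈ I ∧
    ρ.WellFormed I ∧ ∃ σ : Subst C, ρ.head.map (Term.subst σ) = B

/-- An EDB atom of an adorned rule. -/
def IsEDBAtom (I : Set P) (A : Atom (adAr ar C) (Term C)) : Prop :=
  ∃ B : Atom ar (Term C), A = B.unadorned C ∧ B.pred ∉ I

/-- An EDB-adorned program: a finite set of rules whose heads are EDB-adorned atoms and whose body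
atoms are EDB atoms or EDB-adorned atoms. -/
structure IsEDBAdorned (I : Set P) (Pg' : Set (AdRule ar C)) : Prop where
  finite : Pg'.Finite
  head : ∀ R ∈ Pg', IsAdornedAtom I R.head
  body : ∀ R ∈ Pg', ∀ A ∈ R.body, IsEDBAtom I A ∨ IsAdornedAtom I A

/-- The rule `R` of the adorned program is bounded by the adornment `ρ` of its head predicate
`q_ρ`: for every EDB `D`, if `q_ρ(t)` is derived by `R` when the program is evaluated over `D`,
then `q(t)` is derived by `ρ` over `D`. -/
def IsBoundedRule (I : Set P) (Pg' : Set (AdRule ar C)) (R : AdRule ar C) : Prop :=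
  ∀ (q : P) (ρ : Adornment ar C), R.head.pred = .idb q ⟦ρ⟧ →
    ∀ D : Set (Fact ar C), IsEDB I D → ∀ F : Fact ar C,
      F.adorn ⟦ρ⟧ ∈ derivedBy Pg' (adDatabase D) R → F ∈ ρ.eval D

/-- An EDB-bounded program: an EDB-adorned program in which every rule is bounded by the
adornment of its head predicate. -/
structure IsEDBBounded (I : Set P) (Pg' : Set (AdRule ar C)) : Prop where
  adorned : IsEDBAdorned I Pg'
  bounded : ∀ R ∈ Pg', IsBoundedRule I Pg' R

/-- The program and the adorned program are equivalent: over every EDB `D`, every IDB relation `q`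
is the union of the relations `q_ρ` over all adornments `ρ`. -/
def IsEquivalent (Pg : Set (Rule ar C)) (Pg' : Set (AdRule ar C)) : Prop :=
  ∀ D : Set (Fact ar C), IsEDB (idb Pg) D → ∀ q ∈ idb Pg,
    relation Pg D q = ⋃ c : AdornmentClass ar C, relation Pg' (adDatabase D) (.idb q c)

end Adorned

/-! ### The relaxation function `gout` and the membership check `heq` -/

section Parameters

variable {P C : Type*} {ar : P → ℕ}

open Classical in
/-- Replace an argument by the wildcard unless it is a variable in `S`. -/
noncomputable def WTerm.mask (S : Set ℕ) : WTerm C → WTerm C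
  | some (.var x) => if x ∈ S then some (.var x) else none
  | some (.const _) => none
  | none => none

/-- `A` imposes less (or the same) restrictions than `B`: both have the same predicate, and each
argument of `A` is the argument of `B` or a wildcard. -/
def LessRestrictive (A B : Atom ar (WTerm C)) : Prop :=
  ∃ (e : P) (s t : Fin (ar e) → WTerm C), A = ⟨e, s⟩ ∧ B = ⟨e, t⟩ ∧
    ∀ j, s j = t j ∨ s j = none

open Classical in
/-- The body atoms of `ρ`, with all arguments except head variables replaced by wildcards. -/
noncomputable def Adornment.maskedBody (ρ : Adornment ar C) : Finset (Atom ar (WTerm C)) :=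
  ρ.body.image (Atom.map (WTerm.mask ρ.head.vars))

open Classical in
/-- The relaxation function: replace all arguments of body atoms except head variables by
wildcards; then remove the atoms with wildcards only, and the atoms that impose less restrictions
than some other atom. -/
noncomputable def gout (ρ : Adornment ar C) : Adornment ar C where
  head := ρ.head
  body := ρ.maskedBody.filter fun A =>
    (∃ j, A.args j ≠ none) ∧ ∀ B ∈ ρ.maskedBody, LessRestrictive A B → B = A

/-- The membership check: the program contains a rule that is identical to `R` up to renaming of
variables. -/
def heq (R : AdRule ar C) (Pg' : Set (AdRule ar C)) : Prop :=
  ∃ R' ∈ Pg', ∃ π : Equiv.Perm ℕ, R'.rename π = R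

end Parameters

/-! ### The algorithm -/

section Algorithm

variable {P C : Type*} {ar : P → ℕ}

/-- `σ` is a simultaneous unifier of the pairs in `E`. -/
def IsUnifier (σ : Subst C) (E : Set (Atom ar (Term C) × Atom ar (Term C))) : Prop :=
  ∀ e ∈ E, e.1.map (Term.subst σ) = e.2.map (Term.subst σ)

/-- `σ` is a most general simultaneous unifier of the pairs in `E`. -/
def IsMGU (σ : Subst C) (E : Set (Atom ar (Term C) × Atom ar (Term C))) : Prop :=
  IsUnifier σ E ∧ ∀ τ, IsUnifier τ E → ∃ θ : Subst C, ∀ x, τ x = (σ x).subst θ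

open Classical in
/-- The rule `ρ₀ : q(σ(s)) ← σ(ℬ₁), …, σ(ℬ_l), σ(ℰ)`, where `ρ i` is the adornment (with body
`ℬᵢ`) chosen for the body atom of `R` at position `i` if that is an IDB atom, and `ℰ` consists of
the EDB atoms in the body of `R`. -/
noncomputable def inlined (I : Set P) (R : Rule ar C) (ρ : Fin R.body.length → Adornment ar C)
    (σ : Subst C) : Adornment ar C where
  head := R.head.map (Term.subst σ)
  body := Finset.univ.biUnion fun i =>
    if (R.body.get i).pred ∈ I then ((ρ i).subst σ).body
    else {(R.body.get i).map fun t => some (t.subst σ)}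

open Classical in
/-- The adorned rule `q_ρ(σ(s)) ← p_{ρ₁}(σ(s₁)), …, p_{ρ_l}(σ(s_l)), σ(ℰ)` with `ρ = g(ρ₀)`. -/
noncomputable def adornedRule (g : Adornment ar C → Adornment ar C) (I : Set P) (R : Rule ar C)
    (ρ : Fin R.body.length → Adornment ar C) (σ : Subst C) : AdRule ar C where
  head := (R.head.map (Term.subst σ)).adorn ⟦g (inlined I R ρ σ)⟧
  body := List.ofFn fun i =>
    if (R.body.get i).pred ∈ I then ((R.body.get i).map (Term.subst σ)).adorn ⟦ρ i⟧
    else ((R.body.get i).map (Term.subst σ)).unadorned C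

/-- `R'` is a rule which the inner loop of the algorithm constructs when the current adorned
program is `Pg'`: choose a rule `R` of the program; for each IDB atom in its body, choose a rule
of `Pg'` and rename its head atom together with the adornment, which gives the atom `p_ρ(v)` with
adornment `ρ : p(v) ← ℬ`, so that `R` and the chosen head atoms are variable-disjoint; take a most
general simultaneous unifier `σ` of the IDB atoms with the chosen heads, if there is one. -/
def Constructs (g : Adornment ar C → Adornment ar C) (Pg : Set (Rule ar C))
    (Pg' : Set (AdRule ar C)) (R' : AdRule ar C) : Prop :=
  ∃ R ∈ Pg, ∃ (ρ : Fin R.body.length → Adornment ar C) (σ : Subst C),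
    (∀ i, (R.body.get i).pred ∈ idb Pg →
      (ρ i).head.pred = (R.body.get i).pred ∧
      (∃ Ri ∈ Pg', ∃ π : Equiv.Perm ℕ, (Ri.rename π).head = (ρ i).head.adorn ⟦ρ i⟧) ∧
      Disjoint (ρ i).vars R.vars ∧
      ∀ j, (R.body.get j).pred ∈ idb Pg → i ≠ j → Disjoint (ρ i).vars (ρ j).vars) ∧
    IsMGU σ {e | ∃ i, (R.body.get i).pred ∈ idb Pg ∧ e = (R.body.get i, (ρ i).head)} ∧
    R' = adornedRule g (idb Pg) R ρ σ

/-- One addition to the adorned program: a constructed rule is added if the membership check `h`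
is false for it. -/
def Step (g : Adornment ar C → Adornment ar C) (h : AdRule ar C → Set (AdRule ar C) → Prop)
    (Pg : Set (Rule ar C)) (Pg' Pg'' : Set (AdRule ar C)) : Prop :=
  ∃ R', Constructs g Pg Pg' R' ∧ ¬ h R' Pg' ∧ Pg'' = insert R' Pg'

/-- The run of the algorithm that starts with the empty program and makes the additions in some
order can return `Pg'`: `Pg'` is reached after finitely many additions and is a fixpoint, that is,
no further rule is added. -/
def IsOutput (g : Adornment ar C → Adornment ar C) (h : AdRule ar C → Set (AdRule ar C) → Prop)
    (Pg : Set (Rule ar C)) (Pg' : Set (AdRule ar C)) : Prop :=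
  Relation.ReflTransGen (Step g h Pg) ∅ Pg' ∧ ∀ R', Constructs g Pg Pg' R' → h R' Pg'

/-- The algorithm terminates: there is no infinite sequence of additions that starts with the empty
program. -/
def Terminates (g : Adornment ar C → Adornment ar C) (h : AdRule ar C → Set (AdRule ar C) → Prop)
    (Pg : Set (Rule ar C)) : Prop :=
  ¬ ∃ S : ℕ → Set (AdRule ar C), S 0 = ∅ ∧ ∀ n, Step g h Pg (S n) (S (n + 1))

end Algorithm

end Datalog

namespace Datalog

/-! ### Substitutions, renamings and ground instances -/

section Basics

variable {P C T T' T'' : Type*} {ar : P → ℕ}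

/-! Termination is a counting argument. `gout` leaves only head variables in an adornment body, and
a most general unifier introduces no constant that is absent from its equations (`IsMGU.const_mem`).
So every adornment that arises is `Relaxed`: predicates and constants come from the program, and the
arity of the head bounds the number of variables. There are finitely many such adornments up to
renaming (`relaxed_classes_finite`). A constructed rule is determined by the rule of the program,
the classes of the adornments and the unifier on the variables of that rule, so up to renaming there
are finitely many of these too (`exists_finite_representatives`). As `heq` rejects variants, an
infinite run contradicts the pigeonhole principle.

Soundness: call `q_ρ(t)` true if `q(t)` is derived by the program and also by `ρ` alone. True facts
are closed under each constructed rule (`Constructs.apply_trueFacts_subset`): ground derivations by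
the disjoint adornments glue to a ground unifier, which factors through the most general one, so the
inlined rule derives the head (`mem_eval_inlined`), and `gout` only weakens it. This yields
boundedness and one inclusion of the equivalence.

Completeness: by induction on derivations, each derived IDB fact carries some adornment in a
fixpoint of the algorithm. The adornments used for a rule body are renamed apart, the ground
instance shows that their heads are unifiable, and the resulting rule is present up to renaming
(`Invariant.exists_adorn_derived`). -/

theorem Atom.map_map (f : T → T') (g : T' → T'') (A : Atom ar T) :
    (A.map f).map g = A.map (fun t => g (f t)) := rfl

theorem Atom.map_congr {f g : T → T'} {A : Atom ar T} (h : ∀ j, f (A.args j) = g (A.args j)) :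
    A.map f = A.map g := by
  unfold Atom.map
  congr 1
  exact funext h

theorem Term.ground_subst (σ : Subst C) (ν : ℕ → C) (t : Term C) :
    (t.subst σ).ground ν = t.ground fun x => (σ x).ground ν := by
  cases t <;> rfl

theorem Term.ground_congr {ν ν' : ℕ → C} {t : Term C} (h : ∀ x, t = .var x → ν x = ν' x) :
    t.ground ν = t.ground ν' := by
  cases t with
  | var x => exact h x rfl
  | const c => rfl

theorem Term.subst_congr {σ σ' : Subst C} {t : Term C} (h : ∀ x, t = .var x → σ x = σ' x) :
    t.subst σ = t.subst σ' := by
  cases t with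
  | var x => exact h x rfl
  | const c => rfl

theorem Atom.map_ground_congr {ν ν' : ℕ → C} {A : Atom ar (Term C)}
    (h : ∀ x ∈ A.vars, ν x = ν' x) : A.map (Term.ground ν) = A.map (Term.ground ν') :=
  Atom.map_congr fun j => Term.ground_congr fun x hx => h x ⟨j, hx⟩

theorem Atom.map_subst_congr {σ σ' : Subst C} {A : Atom ar (Term C)}
    (h : ∀ x ∈ A.vars, σ x = σ' x) : A.map (Term.subst σ) = A.map (Term.subst σ') :=
  Atom.map_congr fun j => Term.subst_congr fun x hx => h x ⟨j, hx⟩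

theorem Atom.map_ground_subst (σ : Subst C) (ν : ℕ → C) (A : Atom ar (Term C)) :
    (A.map (Term.subst σ)).map (Term.ground ν) = A.map (Term.ground fun x => (σ x).ground ν) := by
  rw [Atom.map_map]
  exact Atom.map_congr fun _ => Term.ground_subst σ ν _

theorem Atom.map_subst_var (A : Atom ar (Term C)) : A.map (Term.subst fun x => .var x) = A := by
  have h : (Term.subst fun x => .var x) = (id : Term C → Term C) := funext Term.subst_var
  rw [h]
  rfl

theorem Rule.head_vars_subset (R : Rule ar C) {x : ℕ} (h : x ∈ R.head.vars) : x ∈ R.vars :=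
  Or.inl h

theorem Rule.body_vars_subset (R : Rule ar C) (i : Fin R.body.length) {x : ℕ}
    (h : x ∈ (R.body.get i).vars) : x ∈ R.vars :=
  Or.inr ⟨_, R.body.get_mem i, h⟩

theorem Atom.vars_finite (A : Atom ar (Term C)) : A.vars.Finite := by
  have : A.vars ⊆ Set.range fun j => match A.args j with
      | .var x => x
      | .const _ => 0 := by
    rintro x ⟨j, hj⟩
    exact ⟨j, by simp [hj]⟩
  exact (Set.finite_range _).subset this

theorem Rule.vars_finite (R : Rule ar C) : R.vars.Finite := by
  refine R.head.vars_finite.union ?_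
  have : {x | ∃ B ∈ R.body, x ∈ B.vars} = ⋃ B ∈ {B | B ∈ R.body}, B.vars := by
    ext x; simp
  rw [this]
  exact (List.finite_toSet R.body).biUnion fun B _ => B.vars_finite

theorem Rule.rename_rename (π π' : Equiv.Perm ℕ) (R : Rule ar C) :
    (R.rename π).rename π' = R.rename (π' * π) := by
  have h : ∀ A : Atom ar (Term C),
      (A.map (Term.subst fun x => .var (π x))).map (Term.subst fun x => .var (π' x)) =
        A.map (Term.subst fun x => .var ((π' * π) x)) := fun A => by
    rw [Atom.map_map]
    exact Atom.map_congr fun j => Term.subst_subst _ _ _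
  unfold Rule.rename Rule.subst
  simp only [h, List.map_map, Function.comp_def]

theorem Rule.rename_one (R : Rule ar C) : R.rename 1 = R := by
  have h : ∀ A : Atom ar (Term C), A.map (Term.subst fun x => .var ((1 : Equiv.Perm ℕ) x)) = A :=
    Atom.map_subst_var
  unfold Rule.rename Rule.subst
  rw [h, funext (g := id) h, List.map_id]

theorem Rule.apply_subst_subset (R : Rule ar C) (σ : Subst C) (I : Set (Fact ar C)) :
    (R.subst σ).apply I ⊆ R.apply I := by
  rintro _ ⟨ν, hν, rfl⟩
  refine ⟨fun x => (σ x).ground ν, fun B hB => ?_, (Atom.map_ground_subst σ ν _).symm⟩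
  rw [← Atom.map_ground_subst]
  exact hν _ (List.mem_map_of_mem hB)

/-- Each of `R` and `R.rename π` is a substitution instance of the other, and an instance derives no
more than the rule itself. -/
theorem Rule.apply_rename (R : Rule ar C) (π : Equiv.Perm ℕ) (I : Set (Fact ar C)) :
    (R.rename π).apply I = R.apply I := by
  refine (R.apply_subst_subset _ I).antisymm ?_
  conv_lhs => rw [← R.rename_one, ← inv_mul_cancel π, ← Rule.rename_rename]
  exact (R.rename π).apply_subst_subset _ I

theorem Adornment.eval_subst_subset (ρ : Adornment ar C) (σ : Subst C) (D : Set (Fact ar C)) :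
    (ρ.subst σ).eval D ⊆ ρ.eval D := by
  classical
  rintro _ ⟨ν, hν, rfl⟩
  refine ⟨fun x => (σ x).ground ν, fun B hB => ?_, (Atom.map_ground_subst σ ν _).symm⟩
  obtain ⟨v, hv, h⟩ := hν (B.map (Option.map (Term.subst σ)))
    (by unfold Adornment.subst; exact Finset.mem_image_of_mem _ hB)
  refine ⟨v, hv, fun j t ht => ?_⟩
  rw [← Term.ground_subst]
  exact h j _ (by simp [Atom.map, ht])

theorem Adornment.eval_rename (ρ : Adornment ar C) (π : Equiv.Perm ℕ) (D : Set (Fact ar C)) :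
    (ρ.rename π).eval D = ρ.eval D := by
  refine (ρ.eval_subst_subset _ D).antisymm ?_
  conv_lhs => rw [← ρ.rename_one, ← inv_mul_cancel π, Adornment.rename_mul]
  exact (ρ.rename π).eval_subst_subset _ D

/-- Makes `eval` well defined on classes, which are all that a predicate `q_ρ` records. -/
theorem Adornment.eval_eq_of_mk_eq {ρ ρ' : Adornment ar C}
    (h : (⟦ρ⟧ : AdornmentClass ar C) = ⟦ρ'⟧) (D : Set (Fact ar C)) : ρ.eval D = ρ'.eval D := by
  obtain ⟨π, rfl⟩ := Quotient.exact h
  exact (ρ.eval_rename π D).symm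

theorem Atom.adorn_inj {A B : Atom ar T} {c d : AdornmentClass ar C}
    (h : A.adorn c = B.adorn d) : A = B ∧ c = d := by
  obtain ⟨p, a⟩ := A
  obtain ⟨q, b⟩ := B
  injection h with hp ha
  injection hp with hp hc
  subst hp
  have ha : a = b := eq_of_heq ha
  exact ⟨by rw [ha], hc⟩

theorem Atom.unadorned_inj {A B : Atom ar T} (h : A.unadorned C = B.unadorned C) : A = B := by
  obtain ⟨p, a⟩ := A
  obtain ⟨q, b⟩ := B
  injection h with hp ha
  injection hp with hp
  subst hp
  have ha : a = b := eq_of_heq ha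
  rw [ha]

theorem Atom.unadorned_ne_adorn {A B : Atom ar T} {c : AdornmentClass ar C} :
    A.unadorned C ≠ B.adorn c := fun h => by
  simpa [Atom.unadorned, Atom.adorn] using congrArg Atom.pred h

end Basics

/-! ### Derivations -/

section Derivations

variable {P C : Type*} {ar : P → ℕ} {Pg : Set (Rule ar C)} {D : Set (Fact ar C)}

theorem consequence_derived (Pg : Set (Rule ar C)) (D : Set (Fact ar C)) :
    D ∪ {F | ∃ R ∈ Pg, F ∈ R.apply (derived Pg D)} = derived Pg D :=
  (consequence Pg D).map_lfp

theorem derived_of_mem {F : Fact ar C} (h : F ∈ D) : F ∈ derived Pg D := by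
  rw [← consequence_derived]
  exact Or.inl h

theorem derived_of_apply {R : Rule ar C} (hR : R ∈ Pg) {F : Fact ar C}
    (h : F ∈ R.apply (derived Pg D)) : F ∈ derived Pg D := by
  rw [← consequence_derived]
  exact Or.inr ⟨R, hR, h⟩

theorem derived_cases {F : Fact ar C} (h : F ∈ derived Pg D) :
    F ∈ D ∨ ∃ R ∈ Pg, F ∈ R.apply (derived Pg D) := by
  rw [← consequence_derived] at h
  exact h

theorem derived_subset {S : Set (Fact ar C)} (hD : D ⊆ S)
    (hS : ∀ R ∈ Pg, R.apply S ⊆ S) : derived Pg D ⊆ S := by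
  refine OrderHom.lfp_le _ ?_
  rintro F (hF | ⟨R, hR, hF⟩)
  · exact hD hF
  · exact hS R hR hF

end Derivations

/-! ### Most general unifiers -/

section Unifiers

variable {P C : Type*} {ar : P → ℕ} {E : Set (Atom ar (Term C) × Atom ar (Term C))}

/-- Without function symbols no unification procedure is needed: a variable forced to one constant
by all unifiers gets that constant, and any other variable gets a representative of the variables on
which all unifiers agree with it. Then every unifier `τ` factors through `σ` via `τ` itself. The
given unifier `τ₀` makes forced constants unique and excludes clashes of constants or predicates. -/
theorem exists_isMGU {τ₀ : Subst C} (h₀ : IsUnifier τ₀ E) : ∃ σ, IsMGU σ E := by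
  classical
  let s : Setoid ℕ :=
    { r := fun x y => ∀ τ, IsUnifier τ E → τ x = τ y
      iseqv := ⟨fun _ _ _ => rfl, fun h τ hτ => (h τ hτ).symm,
        fun h h' τ hτ => (h τ hτ).trans (h' τ hτ)⟩ }
  let rep : ℕ → ℕ := fun x => (Quotient.mk s x).out
  have hrep : ∀ x τ, IsUnifier τ E → τ (rep x) = τ x := fun x => Quotient.mk_out (s := s) x
  let σ : Subst C := fun x =>
    if h : ∃ c, ∀ τ, IsUnifier τ E → τ x = .const c then .const h.choose else .var (rep x)
  have hσ : ∀ x τ, IsUnifier τ E → τ x = (σ x).subst τ := by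
    intro x τ hτ
    simp only [σ]
    split_ifs with h
    · exact h.choose_spec τ hτ
    · exact (hrep x τ hτ).symm
  have hconst : ∀ x c, (∀ τ, IsUnifier τ E → τ x = .const c) → σ x = .const c := by
    intro x c hx
    have h : ∃ c, ∀ τ, IsUnifier τ E → τ x = .const c := ⟨c, hx⟩
    simp only [σ, dif_pos h]
    rw [← h.choose_spec _ h₀, hx _ h₀]
  have hterm : ∀ t u : Term C, (∀ τ, IsUnifier τ E → t.subst τ = u.subst τ) →
      t.subst σ = u.subst σ := by
    rintro (x | c) (y | d) h
    · by_cases hx : ∃ c, ∀ τ, IsUnifier τ E → τ x = .const c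
      · obtain ⟨c, hc⟩ := hx
        have hy : ∀ τ, IsUnifier τ E → τ y = .const c := fun τ hτ => by
          rw [← hc τ hτ]; exact (h τ hτ).symm
        exact (hconst x c hc).trans (hconst y c hy).symm
      · have hy : ¬ ∃ c, ∀ τ, IsUnifier τ E → τ y = .const c := fun ⟨c, hc⟩ =>
          hx ⟨c, fun τ hτ => (h τ hτ).trans (hc τ hτ)⟩
        have hxy : rep x = rep y := congrArg Quotient.out (Quotient.sound (s := s) h)
        simp only [Term.subst, σ, dif_neg hx, dif_neg hy, hxy]
    · exact hconst x d h
    · exact (hconst y c fun τ hτ => (h τ hτ).symm).symm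
    · exact h τ₀ h₀
  refine ⟨σ, ?_, fun τ hτ => ⟨τ, fun x => hσ x τ hτ⟩⟩
  rintro ⟨⟨p, a⟩, ⟨q, b⟩⟩ he
  obtain rfl : p = q := congrArg Atom.pred (h₀ _ he)
  simp only [Atom.map, Atom.mk.injEq, heq_eq_eq, true_and]
  funext j
  refine hterm _ _ fun τ hτ => ?_
  have := hτ _ he
  simp only [Atom.map, Atom.mk.injEq, heq_eq_eq, true_and] at this
  exact congrFun this j

theorem isUnifier_const {τ : ℕ → C}
    (h : ∀ e ∈ E, e.1.map (Term.ground τ) = e.2.map (Term.ground τ)) :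
    IsUnifier (fun x => .const (τ x)) E := by
  have key : (Term.subst fun x => .const (τ x)) = fun t => .const (Term.ground τ t) := by
    funext t
    cases t <;> rfl
  intro e he
  rw [key]
  exact congrArg (Atom.map Term.const) (h e he)

/-- A ground unifier is a ground instance of a most general unifier. -/
theorem IsMGU.exists_ground [Nonempty C] {σ : Subst C} (hσ : IsMGU σ E) {τ : ℕ → C}
    (h : ∀ e ∈ E, e.1.map (Term.ground τ) = e.2.map (Term.ground τ)) :
    ∃ ν : ℕ → C, ∀ x, (σ x).ground ν = τ x := by
  obtain ⟨θ, hθ⟩ := hσ.2 _ (isUnifier_const h)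
  -- `θ` may leave variables where they do not matter; they are grounded arbitrarily.
  let d : ℕ → C := fun _ => Classical.arbitrary C
  refine ⟨fun y => (θ y).ground d, fun x => ?_⟩
  rw [← Term.ground_subst, ← hθ x]
  rfl

/-- A most general unifier introduces no new constants. -/
theorem IsMGU.const_mem {σ : Subst C} (hσ : IsMGU σ E) {x : ℕ} {c : C} (hx : σ x = .const c) :
    ∃ e ∈ E, (∃ j, e.1.args j = .const c) ∨ ∃ j, e.2.args j = .const c := by
  classical
  by_contra! hc
  -- If `c` occurs in no equation, replacing `c` by a variable in the values of `σ` gives another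
  -- unifier. It cannot factor through `σ` at `x`, because `σ x` is already the constant `c`.
  let r : Term C → Term C := fun t => match t with
    | .var y => .var y
    | .const d => if d = c then .var 0 else .const d
  have key : ∀ A : Atom ar (Term C), (∀ j, A.args j ≠ .const c) →
      A.map (Term.subst fun y => r (σ y)) = (A.map (Term.subst σ)).map r := by
    intro A hA
    rw [Atom.map_map]
    refine Atom.map_congr fun j => ?_
    cases h : A.args j with
    | var y => rfl
    | const d =>
      have hd : d ≠ c := fun hd => hA j (hd ▸ h)
      simp [Term.subst, r, hd]
  obtain ⟨θ, hθ⟩ := hσ.2 (fun y => r (σ y)) fun e he => by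
    rw [key _ (hc e he).1, key _ (hc e he).2, hσ.1 e he]
  simpa [hx, r, Term.subst] using hθ x

end Unifiers

/-! ### Adornments made by the relaxation function -/

section Relaxation

variable {P C : Type*} {ar : P → ℕ}

theorem lessRestrictive_iff {p : P} {s t : Fin (ar p) → WTerm C} :
    LessRestrictive (⟨p, s⟩ : Atom ar (WTerm C)) ⟨p, t⟩ ↔ ∀ j, s j = t j ∨ s j = none := by
  constructor
  · rintro ⟨e, s', t', hs, ht, h⟩
    obtain rfl : p = e := congrArg Atom.pred hs
    simp only [Atom.mk.injEq, heq_eq_eq, true_and] at hs ht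
    subst hs ht
    exact h
  · exact fun h => ⟨p, s, t, rfl, rfl, h⟩

theorem LessRestrictive.refl (A : Atom ar (WTerm C)) : LessRestrictive A A :=
  ⟨_, _, _, rfl, rfl, fun _ => Or.inl rfl⟩

theorem LessRestrictive.trans {A B B' : Atom ar (WTerm C)} (h : LessRestrictive A B)
    (h' : LessRestrictive B B') : LessRestrictive A B' := by
  obtain ⟨e, s, t, rfl, rfl, hst⟩ := h
  obtain ⟨e', t', u, ht, rfl, htu⟩ := h'
  obtain rfl : e = e' := congrArg Atom.pred ht
  simp only [Atom.mk.injEq, heq_eq_eq, true_and] at ht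
  subst ht
  refine lessRestrictive_iff.2 fun j => ?_
  rcases hst j with h | h
  · rw [h]
    exact htu j
  · exact Or.inr h

theorem LessRestrictive.antisymm {A B : Atom ar (WTerm C)} (h : LessRestrictive A B)
    (h' : LessRestrictive B A) : A = B := by
  obtain ⟨e, s, t, rfl, rfl, hst⟩ := h
  have hts := lessRestrictive_iff.1 h'
  congr 1
  funext j
  rcases hst j with h | h
  · exact h
  · rcases hts j with h' | h'
    · exact h'.symm
    · rw [h, h']

theorem LessRestrictive.wvars_subset {A B : Atom ar (WTerm C)} (h : LessRestrictive A B) :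
    A.wvars ⊆ B.wvars := by
  obtain ⟨e, s, t, rfl, rfl, hst⟩ := h
  rintro x ⟨j, hj⟩
  refine ⟨j, ?_⟩
  rcases hst j with h | h
  · exact h.symm.trans hj
  · simp [h] at hj

/-- `LessRestrictive` is a partial order, so in a finite set each atom lies below a maximal one.
Hence an atom deleted by `gout` as dominated is dominated by an atom that `gout` does not delete for
this reason. -/
theorem exists_lessRestrictive_maximal {s : Finset (Atom ar (WTerm C))} {A : Atom ar (WTerm C)}
    (hA : A ∈ s) :
    ∃ B ∈ s, LessRestrictive A B ∧ ∀ B' ∈ s, LessRestrictive B B' → B' = B := by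
  let _ : PartialOrder (Atom ar (WTerm C)) :=
    { le := LessRestrictive
      le_refl := LessRestrictive.refl
      le_trans := fun _ _ _ => LessRestrictive.trans
      le_antisymm := fun _ _ => LessRestrictive.antisymm }
  obtain ⟨B, hAB, hB⟩ := Finset.exists_le_maximal s hA
  exact ⟨B, hB.1, hAB, fun B' hB' h => le_antisymm (hB.2 hB' h) h⟩

theorem WTerm.mask_eq_some {S : Set ℕ} {t : WTerm C} {u : Term C} (h : WTerm.mask S t = some u) :
    t = some u ∧ ∃ x ∈ S, u = .var x := by
  unfold WTerm.mask at h
  split at h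
  · split_ifs at h with hx
    obtain rfl := Option.some_injective _ h
    exact ⟨rfl, _, hx, rfl⟩
  · simp at h
  · simp at h

theorem WTerm.mask_var {S : Set ℕ} {x : ℕ} (h : x ∈ S) :
    WTerm.mask S (some (.var x) : WTerm C) = some (.var x) := by
  simp [WTerm.mask, h]

theorem Adornment.mem_maskedBody {ρ : Adornment ar C} {A : Atom ar (WTerm C)} :
    A ∈ ρ.maskedBody ↔ ∃ B ∈ ρ.body, B.map (WTerm.mask ρ.head.vars) = A := by
  classical
  simp [Adornment.maskedBody]

theorem mem_maskedBody_of_mem_gout {ρ : Adornment ar C} {A : Atom ar (WTerm C)}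
    (h : A ∈ (gout ρ).body) : ∃ B ∈ ρ.body, B.map (WTerm.mask ρ.head.vars) = A := by
  classical
  exact Adornment.mem_maskedBody.1 (Finset.mem_filter.1 h).1

/-- The relaxation derives at least the facts of the adornment. -/
theorem eval_subset_eval_gout (ρ : Adornment ar C) (D : Set (Fact ar C)) :
    ρ.eval D ⊆ (gout ρ).eval D := by
  rintro _ ⟨ν, hν, rfl⟩
  refine ⟨ν, fun A hA => ?_, rfl⟩
  obtain ⟨B, hB, rfl⟩ := mem_maskedBody_of_mem_gout hA
  obtain ⟨v, hv, h⟩ := hν B hB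
  exact ⟨v, hv, fun j t ht => h j t (WTerm.mask_eq_some ht).1⟩

/-- The properties of the adornments that the algorithm makes with `gout`: in addition to being
well-formed adornments of IDB predicates, their predicates and constants are taken from the given
sets, and all variables occur in the head. -/
structure Adornment.Relaxed (I Q : Set P) (K : Set C) (ρ : Adornment ar C) : Prop where
  wellFormed : ρ.WellFormed I
  head_idb : ρ.head.pred ∈ I
  body_pred : ∀ B ∈ ρ.body, B.pred ∈ Q
  head_const : ∀ j c, ρ.head.args j = .const c → c ∈ K
  body_vars : ∀ B ∈ ρ.body, B.wvars ⊆ ρ.head.vars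

variable {I Q : Set P} {K : Set C}

theorem relaxed_gout {ρ : Adornment ar C}
    (safe : ∀ x ∈ ρ.head.vars, ∃ B ∈ ρ.body, x ∈ B.wvars) (edb : ∀ B ∈ ρ.body, B.pred ∉ I)
    (head_idb : ρ.head.pred ∈ I) (body_pred : ∀ B ∈ ρ.body, B.pred ∈ Q)
    (head_const : ∀ j c, ρ.head.args j = .const c → c ∈ K) : (gout ρ).Relaxed I Q K where
  wellFormed :=
    { safe := by
        classical
        intro x hx
        obtain ⟨B, hB, j, hj⟩ := safe x hx
        -- Masking keeps `x` because it is a head variable. A maximal atom above the masked one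
        -- still contains `x`, so it is not all wildcards and survives both deletions.
        obtain ⟨A, hA, hBA, hmax⟩ := exists_lessRestrictive_maximal
          (Adornment.mem_maskedBody.2 ⟨B, hB, rfl⟩)
        have hxA : x ∈ A.wvars := hBA.wvars_subset ⟨j, by
          simp only [Atom.map, hj]
          exact WTerm.mask_var hx⟩
        refine ⟨A, Finset.mem_filter.2 ⟨hA, ?_, hmax⟩, hxA⟩
        obtain ⟨k, hk⟩ := hxA
        exact ⟨k, by simp [hk]⟩
      edb := by
        intro A hA
        obtain ⟨B, hB, rfl⟩ := mem_maskedBody_of_mem_gout hA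
        exact edb B hB
      var_or_wild := by
        intro A hA j
        obtain ⟨B, hB, rfl⟩ := mem_maskedBody_of_mem_gout hA
        rcases h : (B.map (WTerm.mask ρ.head.vars)).args j with _ | u
        · exact Or.inl rfl
        · obtain ⟨-, x, -, rfl⟩ := WTerm.mask_eq_some h
          exact Or.inr ⟨x, rfl⟩ }
  head_idb := head_idb
  body_pred := by
    intro A hA
    obtain ⟨B, hB, rfl⟩ := mem_maskedBody_of_mem_gout hA
    exact body_pred B hB
  head_const := head_const
  body_vars := by
    rintro A hA x ⟨j, hj⟩
    obtain ⟨B, hB, rfl⟩ := mem_maskedBody_of_mem_gout hA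
    obtain ⟨-, y, hy, h⟩ := WTerm.mask_eq_some hj
    obtain rfl : x = y := by simpa using h
    exact hy

theorem Adornment.mem_subst_body {ρ : Adornment ar C} {σ : Subst C} {A : Atom ar (WTerm C)} :
    A ∈ (ρ.subst σ).body ↔ ∃ B ∈ ρ.body, B.map (Option.map (Term.subst σ)) = A := by
  classical
  simp [Adornment.subst]

theorem Term.rename_eq_var {π : Equiv.Perm ℕ} {t : Term C} {x : ℕ}
    (h : t.subst (fun x => .var (π x)) = .var x) : ∃ y, t = .var y ∧ π y = x := by
  cases t with
  | var y => exact ⟨y, rfl, by simpa [Term.subst] using h⟩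
  | const c => simp [Term.subst] at h

theorem Atom.mem_rename_vars {π : Equiv.Perm ℕ} {A : Atom ar (Term C)} {x : ℕ} :
    x ∈ (A.map (Term.subst fun x => .var (π x))).vars ↔ ∃ y ∈ A.vars, π y = x := by
  constructor
  · rintro ⟨j, hj⟩
    obtain ⟨y, hy, h⟩ := Term.rename_eq_var hj
    exact ⟨y, ⟨j, hy⟩, h⟩
  · rintro ⟨y, ⟨j, hj⟩, rfl⟩
    exact ⟨j, by simp [Atom.map, hj, Term.subst]⟩

theorem Atom.mem_rename_wvars {π : Equiv.Perm ℕ} {A : Atom ar (WTerm C)} {x : ℕ} :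
    x ∈ (A.map (Option.map (Term.subst fun x => .var (π x)))).wvars ↔
      ∃ y ∈ A.wvars, π y = x := by
  constructor
  · rintro ⟨j, hj⟩
    obtain ⟨t, ht, h⟩ := Option.map_eq_some_iff.1 hj
    obtain ⟨y, rfl, hy⟩ := Term.rename_eq_var h
    exact ⟨y, ⟨j, ht⟩, hy⟩
  · rintro ⟨y, ⟨j, hj⟩, rfl⟩
    exact ⟨j, by simp [Atom.map, hj, Term.subst]⟩

theorem Adornment.mem_rename_vars {π : Equiv.Perm ℕ} {ρ : Adornment ar C} {x : ℕ} :
    x ∈ (ρ.rename π).vars ↔ ∃ y ∈ ρ.vars, π y = x := by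
  constructor
  · rintro (h | ⟨B, hB, h⟩)
    · obtain ⟨y, hy, rfl⟩ := Atom.mem_rename_vars.1 h
      exact ⟨y, Or.inl hy, rfl⟩
    · obtain ⟨A, hA, rfl⟩ := Adornment.mem_subst_body.1 hB
      obtain ⟨y, hy, rfl⟩ := Atom.mem_rename_wvars.1 h
      exact ⟨y, Or.inr ⟨A, hA, hy⟩, rfl⟩
  · rintro ⟨y, hy | ⟨B, hB, hy⟩, rfl⟩
    · exact Or.inl (Atom.mem_rename_vars.2 ⟨y, hy, rfl⟩)
    · exact Or.inr ⟨_, Adornment.mem_subst_body.2 ⟨B, hB, rfl⟩,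
        Atom.mem_rename_wvars.2 ⟨y, hy, rfl⟩⟩

theorem Adornment.Relaxed.rename {ρ : Adornment ar C} (h : ρ.Relaxed I Q K)
    (π : Equiv.Perm ℕ) : (ρ.rename π).Relaxed I Q K where
  wellFormed :=
    { safe := by
        intro x hx
        obtain ⟨y, hy, rfl⟩ := Atom.mem_rename_vars.1 hx
        obtain ⟨B, hB, hy⟩ := h.wellFormed.safe y hy
        exact ⟨_, Adornment.mem_subst_body.2 ⟨B, hB, rfl⟩, Atom.mem_rename_wvars.2 ⟨y, hy, rfl⟩⟩
      edb := by
        intro A hA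
        obtain ⟨B, hB, rfl⟩ := Adornment.mem_subst_body.1 hA
        exact h.wellFormed.edb B hB
      var_or_wild := by
        intro A hA j
        obtain ⟨B, hB, rfl⟩ := Adornment.mem_subst_body.1 hA
        rcases h.wellFormed.var_or_wild B hB j with hj | ⟨x, hj⟩
        · exact Or.inl (by simp [Atom.map, hj])
        · exact Or.inr ⟨π x, by simp [Atom.map, hj, Term.subst]⟩ }
  head_idb := h.head_idb
  body_pred := by
    intro A hA
    obtain ⟨B, hB, rfl⟩ := Adornment.mem_subst_body.1 hA
    exact h.body_pred B hB
  head_const := by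
    intro j c hj
    refine h.head_const j c ?_
    change (ρ.head.args j).subst _ = _ at hj
    cases hρ : ρ.head.args j with
    | var x => simp [hρ, Term.subst] at hj
    | const d => simpa [hρ, Term.subst] using hj
  body_vars := by
    intro A hA x hx
    obtain ⟨B, hB, rfl⟩ := Adornment.mem_subst_body.1 hA
    obtain ⟨y, hy, rfl⟩ := Atom.mem_rename_wvars.1 hx
    exact Atom.mem_rename_vars.2 ⟨y, h.body_vars B hB hy, rfl⟩

/-- All rules of the adorned program have heads `q_ρ(s)` such that `ρ` has the head `q(s)` and
`ρ` is relaxed. -/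
def RelaxedHeads (I Q : Set P) (K : Set C) (Pg' : Set (AdRule ar C)) : Prop :=
  ∀ R ∈ Pg', ∃ ρ : Adornment ar C, ρ.Relaxed I Q K ∧ R.head = ρ.head.adorn ⟦ρ⟧

/-- The algorithm picks any `ρ` that matches a renamed head. Equality of predicates only fixes the
class of `ρ`, but relaxedness is invariant under renaming. -/
theorem RelaxedHeads.relaxed {Pg' : Set (AdRule ar C)} (h : RelaxedHeads I Q K Pg')
    {R : AdRule ar C} (hR : R ∈ Pg') {π : Equiv.Perm ℕ} {ρ : Adornment ar C}
    (hρ : (R.rename π).head = ρ.head.adorn ⟦ρ⟧) : ρ.Relaxed I Q K := by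
  obtain ⟨ρ', hρ', hR'⟩ := h R hR
  have h1 : (ρ'.rename π).head.adorn ⟦ρ'⟧ = ρ.head.adorn ⟦ρ⟧ := by
    rw [← hρ]
    change _ = R.head.map _
    rw [hR']
    rfl
  obtain ⟨π', rfl⟩ := Quotient.exact (Atom.adorn_inj h1).2
  exact hρ'.rename π'

end Relaxation

/-! ### The constructed rules -/

section Constructed

variable {P C : Type*} {ar : P → ℕ}

open Classical in
/-- The adorned rule made from the rule `R` with the classes of adornments `c` for the head and
`cs i` for the IDB atoms of the body, and the substitution `σ`. -/
noncomputable def ruleOfClasses (I : Set P) (R : Rule ar C) (c : AdornmentClass ar C)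
    (cs : Fin R.body.length → AdornmentClass ar C) (σ : Subst C) : AdRule ar C where
  head := (R.head.map (Term.subst σ)).adorn c
  body := List.ofFn fun i =>
    if (R.body.get i).pred ∈ I then ((R.body.get i).map (Term.subst σ)).adorn (cs i)
    else ((R.body.get i).map (Term.subst σ)).unadorned C

/-- Shows that the rule depends on the adornments only through their classes, on which the
finiteness count rests. -/
theorem adornedRule_eq_ruleOfClasses (g : Adornment ar C → Adornment ar C) (I : Set P)
    (R : Rule ar C) (ρ : Fin R.body.length → Adornment ar C) (σ : Subst C) :
    adornedRule g I R ρ σ = ruleOfClasses I R ⟦g (inlined I R ρ σ)⟧ (fun i => ⟦ρ i⟧) σ := rfl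

theorem ruleOfClasses_fires {I : Set P} {R : Rule ar C} {c : AdornmentClass ar C}
    {cs : Fin R.body.length → AdornmentClass ar C} {σ : Subst C}
    {J : Set (Fact (adAr ar C) C)} {ν : ℕ → C} :
    (ruleOfClasses I R c cs σ).Fires J ν ↔ ∀ i,
      ((R.body.get i).pred ∈ I →
        ((R.body.get i).map (Term.ground fun x => (σ x).ground ν)).adorn (cs i) ∈ J) ∧
      ((R.body.get i).pred ∉ I →
        ((R.body.get i).map (Term.ground fun x => (σ x).ground ν)).unadorned C ∈ J) := by
  simp only [Rule.Fires, ruleOfClasses, List.mem_ofFn, forall_exists_index,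
    forall_apply_eq_imp_iff, ← Atom.map_ground_subst]
  refine forall_congr' fun i => ?_
  by_cases h : (R.body.get i).pred ∈ I
  · simp only [h, if_true, true_imp_iff, not_true, false_imp_iff, and_true]
    rfl
  · simp only [h, if_false, not_false_iff, true_imp_iff, false_imp_iff, true_and]
    rfl

theorem ruleOfClasses_head_ground {I : Set P} {R : Rule ar C} {c : AdornmentClass ar C}
    {cs : Fin R.body.length → AdornmentClass ar C} {σ : Subst C} {ν : ℕ → C} :
    (ruleOfClasses I R c cs σ).head.map (Term.ground ν) =
      (R.head.map (Term.ground fun x => (σ x).ground ν)).adorn c := by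
  rw [← Atom.map_ground_subst]
  rfl

theorem mem_inlined_body {I : Set P} {R : Rule ar C} {ρ : Fin R.body.length → Adornment ar C}
    {σ : Subst C} {A : Atom ar (WTerm C)} :
    A ∈ (inlined I R ρ σ).body ↔ ∃ i,
      ((R.body.get i).pred ∈ I ∧ A ∈ ((ρ i).subst σ).body) ∨
      ((R.body.get i).pred ∉ I ∧ A = (R.body.get i).map fun t => some (t.subst σ)) := by
  classical
  simp only [inlined, Finset.mem_biUnion, Finset.mem_univ, true_and]
  refine exists_congr fun i => ?_
  by_cases h : (R.body.get i).pred ∈ I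
  · simp only [h, if_true, true_and, not_true, false_and, or_false]
  · simp only [h, if_false, not_false_iff, true_and, false_and, false_or, Finset.mem_singleton]

/-- The predicates in the bodies of the rules. -/
def bodyPreds (Pg : Set (Rule ar C)) : Set P := {p | ∃ R ∈ Pg, ∃ B ∈ R.body, B.pred = p}

/-- The constants of a program. -/
def constants (Pg : Set (Rule ar C)) : Set C :=
  {c | ∃ R ∈ Pg, ∃ A ∈ R.head :: R.body, ∃ j, A.args j = .const c}

/-- The equations that are solved to make an adorned rule. -/
def equations (I : Set P) (R : Rule ar C) (ρ : Fin R.body.length → Adornment ar C) :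
    Set (Atom ar (Term C) × Atom ar (Term C)) :=
  {e | ∃ i, (R.body.get i).pred ∈ I ∧ e = (R.body.get i, (ρ i).head)}

variable {Pg : Set (Rule ar C)} {R : Rule ar C} {ρ : Fin R.body.length → Adornment ar C}
  {σ : Subst C}

theorem IsMGU.const_mem_constants (hR : R ∈ Pg)
    (hρ : ∀ i, (R.body.get i).pred ∈ idb Pg →
      (ρ i).Relaxed (idb Pg) (bodyPreds Pg) (constants Pg))
    (hσ : IsMGU σ (equations (idb Pg) R ρ)) {x : ℕ} {c : C} (hx : σ x = .const c) :
    c ∈ constants Pg := by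
  obtain ⟨_, ⟨i, hi, rfl⟩, ⟨j, hj⟩ | ⟨j, hj⟩⟩ := hσ.const_mem hx
  · exact ⟨R, hR, _, List.mem_cons_of_mem _ (R.body.get_mem i), j, hj⟩
  · exact (hρ i hi).head_const j c hj

theorem Atom.mem_subst_vars {A : Atom ar (Term C)} {x : ℕ}
    (h : x ∈ (A.map (Term.subst σ)).vars) : ∃ y ∈ A.vars, σ y = .var x := by
  obtain ⟨j, hj⟩ := h
  change (A.args j).subst σ = _ at hj
  cases hA : A.args j with
  | var y =>
    rw [hA] at hj
    exact ⟨y, ⟨j, hA⟩, hj⟩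
  | const c => simp [hA, Term.subst] at hj

theorem Atom.subst_vars_of_mem {A : Atom ar (Term C)} {x y : ℕ} (hy : y ∈ A.vars)
    (h : σ y = .var x) : x ∈ (A.map (Term.subst σ)).vars := by
  obtain ⟨j, hj⟩ := hy
  exact ⟨j, by simp [Atom.map, hj, Term.subst, h]⟩

theorem relaxed_gout_inlined (hPg : IsProgram Pg) (hR : R ∈ Pg)
    (hρ : ∀ i, (R.body.get i).pred ∈ idb Pg →
      (ρ i).Relaxed (idb Pg) (bodyPreds Pg) (constants Pg))
    (hσ : IsMGU σ (equations (idb Pg) R ρ)) :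
    (gout (inlined (idb Pg) R ρ σ)).Relaxed (idb Pg) (bodyPreds Pg) (constants Pg) := by
  refine relaxed_gout ?_ ?_ (hPg.head_idb R hR) ?_ ?_
  · intro x hx
    obtain ⟨y, hy, hyx⟩ := Atom.mem_subst_vars hx
    obtain ⟨B, hB, hyB⟩ := hPg.safe R hR y hy
    obtain ⟨i, rfl⟩ := List.mem_iff_get.1 hB
    by_cases hi : (R.body.get i).pred ∈ idb Pg
    · have hx' := Atom.subst_vars_of_mem hyB hyx
      -- The unified body atom is also the instance of the head of `ρ i`, so `x` comes from a head
      -- variable of `ρ i`, which by safety occurs in the body of `ρ i`.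
      rw [hσ.1 _ ⟨i, hi, rfl⟩] at hx'
      obtain ⟨z, hz, hzx⟩ := Atom.mem_subst_vars hx'
      obtain ⟨A, hA, j, hj⟩ := (hρ i hi).wellFormed.safe z hz
      refine ⟨_, mem_inlined_body.2
        ⟨i, Or.inl ⟨hi, Adornment.mem_subst_body.2 ⟨A, hA, rfl⟩⟩⟩, j, ?_⟩
      simp [Atom.map, hj, Term.subst, hzx]
    · obtain ⟨j, hj⟩ := hyB
      refine ⟨_, mem_inlined_body.2 ⟨i, Or.inr ⟨hi, rfl⟩⟩, j, ?_⟩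
      have hj : (R.body.get i).args j = .var y := hj
      simp only [Atom.map, hj, Term.subst, hyx]
  · intro A hA
    obtain ⟨i, ⟨hi, hA⟩ | ⟨hi, rfl⟩⟩ := mem_inlined_body.1 hA
    · obtain ⟨B, hB, rfl⟩ := Adornment.mem_subst_body.1 hA
      exact (hρ i hi).wellFormed.edb B hB
    · exact hi
  · intro A hA
    obtain ⟨i, ⟨hi, hA⟩ | ⟨hi, rfl⟩⟩ := mem_inlined_body.1 hA
    · obtain ⟨B, hB, rfl⟩ := Adornment.mem_subst_body.1 hA
      exact (hρ i hi).body_pred B hB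
    · exact ⟨R, hR, _, R.body.get_mem i, rfl⟩
  · intro j c hj
    change (R.head.args j).subst σ = _ at hj
    cases h : R.head.args j with
    | var y =>
      rw [h] at hj
      exact IsMGU.const_mem_constants hR hρ hσ hj
    | const d =>
      rw [h] at hj
      exact ⟨R, hR, R.head, List.mem_cons_self, j, h.trans hj⟩

/-- Valuations on pairwise disjoint sets of variables glue to a single one. -/
theorem exists_valuation_extending {n : ℕ} (I : Fin n → Prop) {V : Set ℕ} {W : Fin n → Set ℕ}
    (hV : ∀ i, I i → Disjoint (W i) V)
    (hW : ∀ i, I i → ∀ j, I j → i ≠ j → Disjoint (W i) (W j)) (ν : ℕ → C) (νs : Fin n → ℕ → C) :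
    ∃ τ : ℕ → C, (∀ x ∈ V, τ x = ν x) ∧ ∀ i, I i → ∀ x ∈ W i, τ x = νs i x := by
  classical
  refine ⟨fun x => if h : ∃ i, I i ∧ x ∈ W i then νs h.choose x else ν x, ?_, ?_⟩
  · intro x hx
    have h : ¬ ∃ i, I i ∧ x ∈ W i := fun ⟨i, hi, hxi⟩ =>
      Set.disjoint_left.1 (hV i hi) hxi hx
    simp only [dif_neg h]
  · intro i hi x hx
    have h : ∃ i, I i ∧ x ∈ W i := ⟨i, hi, hx⟩
    have : h.choose = i := by
      by_contra hne
      exact Set.disjoint_left.1 (hW _ h.choose_spec.1 i hi hne) h.choose_spec.2 hx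
    simp only [dif_pos h, this]

/-- A ground instance of the rule whose IDB atoms are derived by the variable-disjoint adornments
yields a ground unifier. -/
theorem exists_ground_unifier {I : Set P} {D : Set (Fact ar C)}
    (hdisj : ∀ i, (R.body.get i).pred ∈ I → Disjoint (ρ i).vars R.vars ∧
      ∀ j, (R.body.get j).pred ∈ I → i ≠ j → Disjoint (ρ i).vars (ρ j).vars) {ν : ℕ → C}
    (hν : ∀ i, (R.body.get i).pred ∈ I →
      (R.body.get i).map (Term.ground ν) ∈ (ρ i).eval D) :
    ∃ τ : ℕ → C, (∀ x ∈ R.vars, τ x = ν x) ∧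
      (∀ e ∈ equations I R ρ, e.1.map (Term.ground τ) = e.2.map (Term.ground τ)) ∧
      ∀ i, (R.body.get i).pred ∈ I → ∀ B ∈ (ρ i).body, ∃ v : Fin (ar B.pred) → C,
        (⟨B.pred, v⟩ : Fact ar C) ∈ D ∧
          ∀ j, ∀ t : Term C, B.args j = some t → t.ground τ = v j := by
  have hν' : ∀ i, ∃ ν' : ℕ → C, (R.body.get i).pred ∈ I →
      (∀ B ∈ (ρ i).body, ∃ v : Fin (ar B.pred) → C, (⟨B.pred, v⟩ : Fact ar C) ∈ D ∧
        ∀ j, ∀ t : Term C, B.args j = some t → t.ground ν' = v j) ∧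
      (ρ i).head.map (Term.ground ν') = (R.body.get i).map (Term.ground ν) := by
    intro i
    by_cases hi : (R.body.get i).pred ∈ I
    · obtain ⟨ν', h⟩ := hν i hi
      exact ⟨ν', fun _ => h⟩
    · exact ⟨ν, fun h => absurd h hi⟩
  choose νs hνs using hν'
  obtain ⟨τ, hτ, hτs⟩ := exists_valuation_extending (fun i => (R.body.get i).pred ∈ I)
    (fun i hi => (hdisj i hi).1) (fun i hi => (hdisj i hi).2) ν νs
  refine ⟨τ, hτ, ?_, fun i hi B hB => ?_⟩
  · rintro _ ⟨i, hi, rfl⟩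
    have h1 : (R.body.get i).map (Term.ground τ) = (R.body.get i).map (Term.ground ν) :=
      Atom.map_ground_congr fun x hx => hτ x (R.body_vars_subset i hx)
    have h2 : (ρ i).head.map (Term.ground τ) = (ρ i).head.map (Term.ground (νs i)) :=
      Atom.map_ground_congr fun x hx => hτs i hi x (Or.inl hx)
    exact h1.trans ((hνs i hi).2.symm.trans h2.symm)
  · obtain ⟨v, hv, h⟩ := (hνs i hi).1 B hB
    refine ⟨v, hv, fun j t ht => (Term.ground_congr fun x hx => ?_).trans (h j t ht)⟩
    exact hτs i hi x (Or.inr ⟨B, hB, j, hx ▸ ht⟩)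

/-- What the rule derives from facts derived by the adornments is derived by the rule in which the
adornments are inlined. -/
theorem mem_eval_inlined [Nonempty C] {I : Set P} {D : Set (Fact ar C)}
    (hdisj : ∀ i, (R.body.get i).pred ∈ I → Disjoint (ρ i).vars R.vars ∧
      ∀ j, (R.body.get j).pred ∈ I → i ≠ j → Disjoint (ρ i).vars (ρ j).vars)
    (hσ : IsMGU σ (equations I R ρ)) {ν : ℕ → C}
    (hν : ∀ i, ((R.body.get i).pred ∈ I →
        (R.body.get i).map (Term.ground ν) ∈ (ρ i).eval D) ∧
      ((R.body.get i).pred ∉ I → (R.body.get i).map (Term.ground ν) ∈ D)) :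
    R.head.map (Term.ground ν) ∈ (inlined I R ρ σ).eval D := by
  obtain ⟨τ, hτ, hE, hbody⟩ := exists_ground_unifier hdisj fun i => (hν i).1
  -- The glued valuation `τ` equals `σ` followed by `ν'`, so `ν'` is the valuation under which the
  -- inlined rule fires.
  obtain ⟨ν', hν'⟩ := hσ.exists_ground hE
  have hfun : (fun x => (σ x).ground ν') = τ := funext hν'
  refine ⟨ν', fun A hA => ?_, ?_⟩
  · obtain ⟨i, ⟨hi, hA⟩ | ⟨hi, rfl⟩⟩ := mem_inlined_body.1 hA
    · obtain ⟨B, hB, rfl⟩ := Adornment.mem_subst_body.1 hA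
      obtain ⟨v, hv, h⟩ := hbody i hi B hB
      refine ⟨v, hv, fun j t ht => ?_⟩
      obtain ⟨u, hu, rfl⟩ := Option.map_eq_some_iff.1 ht
      rw [Term.ground_subst, hfun]
      exact h j u hu
    · refine ⟨_, (hν i).2 hi, fun j t ht => ?_⟩
      obtain rfl : ((R.body.get i).args j).subst σ = t := Option.some_injective _ ht
      rw [Term.ground_subst, hfun]
      exact Term.ground_congr fun x hx => hτ x (R.body_vars_subset i ⟨j, hx⟩)
  · change (R.head.map (Term.subst σ)).map _ = _
    rw [Atom.map_ground_subst, hfun]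
    exact Atom.map_ground_congr fun x hx => hτ x (R.head_vars_subset hx)

/-! ### The invariant of the algorithm -/

/-- The current program is only asked to contain certain rules, so a rule remains constructible as
the program grows. The invariant can thus refer to the current program instead of the stage of each
addition. -/
theorem Constructs.mono {g : Adornment ar C → Adornment ar C} {S S' : Set (AdRule ar C)}
    {R' : AdRule ar C} (h : Constructs g Pg S R') (hS : S ⊆ S') : Constructs g Pg S' R' := by
  obtain ⟨R, hR, ρ, σ, hρ, hσ, rfl⟩ := h
  refine ⟨R, hR, ρ, σ, fun i hi => ?_, hσ, rfl⟩
  obtain ⟨h1, ⟨Ri, hRi, h2⟩, h3⟩ := hρ i hi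
  exact ⟨h1, ⟨Ri, hS hRi, h2⟩, h3⟩

/-- The invariant of the algorithm. -/
structure Invariant (Pg : Set (Rule ar C)) (S : Set (AdRule ar C)) : Prop where
  finite : S.Finite
  heads : RelaxedHeads (idb Pg) (bodyPreds Pg) (constants Pg) S
  constructs : ∀ R' ∈ S, Constructs gout Pg S R'

theorem RelaxedHeads.choice {S : Set (AdRule ar C)} {I Q : Set P} {K : Set C}
    (hS : RelaxedHeads I Q K S)
    (hρ : ∀ i, (R.body.get i).pred ∈ I →
      (ρ i).head.pred = (R.body.get i).pred ∧
      (∃ Ri ∈ S, ∃ π : Equiv.Perm ℕ, (Ri.rename π).head = (ρ i).head.adorn ⟦ρ i⟧) ∧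
      Disjoint (ρ i).vars R.vars ∧
      ∀ j, (R.body.get j).pred ∈ I → i ≠ j → Disjoint (ρ i).vars (ρ j).vars) :
    ∀ i, (R.body.get i).pred ∈ I → (ρ i).Relaxed I Q K := by
  intro i hi
  obtain ⟨-, ⟨Ri, hRi, π, hπ⟩, -⟩ := hρ i hi
  exact hS.relaxed hRi hπ

theorem Invariant.step (hPg : IsProgram Pg) {S S' : Set (AdRule ar C)} (hS : Invariant Pg S)
    (h : Step gout heq Pg S S') : Invariant Pg S' := by
  obtain ⟨R', hR', -, rfl⟩ := h
  refine ⟨hS.finite.insert _, ?_, ?_⟩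
  · rintro R₁ (rfl | hR₁)
    · obtain ⟨R, hR, ρ, σ, hρ, hσ, rfl⟩ := hR'
      exact ⟨_, relaxed_gout_inlined hPg hR (hS.heads.choice hρ) hσ, rfl⟩
    · exact hS.heads R₁ hR₁
  · rintro R₁ (rfl | hR₁)
    · exact hR'.mono (Set.subset_insert _ _)
    · exact (hS.constructs R₁ hR₁).mono (Set.subset_insert _ _)

theorem Invariant.empty : Invariant Pg (∅ : Set (AdRule ar C)) :=
  ⟨Set.finite_empty, fun _ h => h.elim, fun _ h => h.elim⟩

theorem Invariant.of_reachable (hPg : IsProgram Pg) {S : Set (AdRule ar C)}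
    (h : Relation.ReflTransGen (Step gout heq Pg) ∅ S) : Invariant Pg S := by
  induction h with
  | refl => exact Invariant.empty
  | tail _ h ih => exact ih.step hPg h

/-! ### Soundness -/

/-- Facts over the predicates of the adorned program that are true: facts of the database, and
facts `q_ρ(t)` such that `q(t)` is derived by the program as well as by the adornment. -/
def trueFacts (Pg : Set (Rule ar C)) (D : Set (Fact ar C)) : Set (Fact (adAr ar C) C) :=
  {G | (∃ F ∈ D, G = F.unadorned C) ∨
    ∃ F ∈ derived Pg D, ∃ ρ : Adornment ar C, F ∈ ρ.eval D ∧ G = F.adorn ⟦ρ⟧}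

theorem unadorned_mem_trueFacts {D : Set (Fact ar C)} {F : Fact ar C}
    (h : F.unadorned C ∈ trueFacts Pg D) : F ∈ D := by
  obtain ⟨F', hF', h⟩ | ⟨F', -, ρ, -, h⟩ := h
  · exact Atom.unadorned_inj h ▸ hF'
  · exact absurd h Atom.unadorned_ne_adorn

theorem adorn_mem_trueFacts {D : Set (Fact ar C)} {F : Fact ar C} {ρ : Adornment ar C}
    (h : F.adorn ⟦ρ⟧ ∈ trueFacts Pg D) : F ∈ derived Pg D ∧ F ∈ ρ.eval D := by
  obtain ⟨F', -, h⟩ | ⟨F', hF', ρ', hρ', h⟩ := h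
  · exact absurd h.symm Atom.unadorned_ne_adorn
  · obtain ⟨rfl, hc⟩ := Atom.adorn_inj h
    exact ⟨hF', Adornment.eval_eq_of_mk_eq hc D ▸ hρ'⟩

theorem Constructs.apply_trueFacts_subset [Nonempty C] {S : Set (AdRule ar C)}
    {R' : AdRule ar C} (h : Constructs gout Pg S R') (D : Set (Fact ar C)) :
    R'.apply (trueFacts Pg D) ⊆ trueFacts Pg D := by
  obtain ⟨R, hR, ρ, σ, hρ, hσ, rfl⟩ := h
  rintro _ ⟨ν, hν, rfl⟩
  rw [adornedRule_eq_ruleOfClasses] at hν ⊢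
  rw [ruleOfClasses_fires] at hν
  rw [ruleOfClasses_head_ground]
  refine Or.inr ⟨_, derived_of_apply hR ⟨_, fun B hB => ?_, rfl⟩, _,
    eval_subset_eval_gout _ _ (mem_eval_inlined (fun i hi => (hρ i hi).2.2) hσ fun i =>
      ⟨fun hi => (adorn_mem_trueFacts ((hν i).1 hi)).2,
        fun hi => unadorned_mem_trueFacts ((hν i).2 hi)⟩), rfl⟩
  obtain ⟨i, rfl⟩ := List.mem_iff_get.1 hB
  by_cases hi : (R.body.get i).pred ∈ idb Pg
  · exact (adorn_mem_trueFacts ((hν i).1 hi)).1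
  · exact derived_of_mem (unadorned_mem_trueFacts ((hν i).2 hi))

/-- The true facts contain the database and are closed under all rules, so they contain the least
fixpoint. -/
theorem Invariant.derived_subset_trueFacts [Nonempty C] {S : Set (AdRule ar C)}
    (hS : Invariant Pg S) (D : Set (Fact ar C)) :
    derived S (adDatabase D) ⊆ trueFacts Pg D :=
  derived_subset (fun _ h => Or.inl h) fun R' hR' =>
    (hS.constructs R' hR').apply_trueFacts_subset D

theorem Invariant.isEDBBounded [Nonempty C] {S : Set (AdRule ar C)}
    (hS : Invariant Pg S) : IsEDBBounded (idb Pg) S where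
  adorned :=
    { finite := hS.finite
      head := by
        intro R' hR'
        obtain ⟨ρ, hρ, h⟩ := hS.heads R' hR'
        exact ⟨ρ.head, ρ, h, hρ.head_idb, hρ.wellFormed, _, ρ.head.map_subst_var⟩
      body := by
        intro R' hR' A hA
        obtain ⟨R, hR, ρ, σ, hρ, hσ, rfl⟩ := hS.constructs R' hR'
        obtain ⟨i, rfl⟩ := List.mem_ofFn.1 hA
        by_cases hi : (R.body.get i).pred ∈ idb Pg
        · simp only [hi, if_true]
          -- As `σ` unifies, the adorned body atom is the instance under `σ` of the head of `ρ i`.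
          exact Or.inr ⟨_, ρ i, rfl, hi, (hS.heads.choice hρ i hi).wellFormed, σ,
            (hσ.1 _ ⟨i, hi, rfl⟩).symm⟩
        · simp only [hi, if_false]
          exact Or.inl ⟨_, rfl, hi⟩ }
  bounded := by
    intro R' hR' q ρ _ D _ F hF
    exact (adorn_mem_trueFacts (hS.derived_subset_trueFacts D (derived_of_apply hR' hF))).2

end Constructed

/-! ### Permutations of the variables -/

section Permutations

theorem exists_perm_extending {n : ℕ} (f g : Fin n ↪ ℕ) :
    ∃ π : Equiv.Perm ℕ, ∀ i, π (f i) = g i := by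
  have := Equiv.Perm.isMultiplyPretransitive ℕ n
  obtain ⟨π, h⟩ := MulAction.exists_smul_eq (Equiv.Perm ℕ) f g
  exact ⟨π, fun i => DFunLike.congr_fun h i⟩

/-- Finitely many variables can be renamed to the first ones. -/
theorem exists_perm_lt_card {α : Type*} [Fintype α] (f : α → ℕ) :
    ∃ π : Equiv.Perm ℕ, ∀ a, π (f a) < Fintype.card α := by
  classical
  let s := Finset.univ.image f
  -- `f` need not be injective, so its image is enumerated, and that has at most `Fintype.card α`
  -- elements.
  obtain ⟨π, hπ⟩ := exists_perm_extending
    (s.equivFin.symm.toEmbedding.trans (Function.Embedding.subtype _)) Fin.valEmbedding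
  refine ⟨π, fun a => ?_⟩
  have ha : f a ∈ s := Finset.mem_image_of_mem f (Finset.mem_univ a)
  have h := hπ (s.equivFin ⟨f a, ha⟩)
  simp only [Function.Embedding.trans_apply, Equiv.coe_toEmbedding, Equiv.symm_apply_apply,
    Function.Embedding.subtype_apply, Fin.valEmbedding_apply] at h
  rw [h]
  exact (Fin.is_lt _).trans_le Finset.card_image_le

/-- Finitely many finite sets of variables can be renamed apart. -/
theorem exists_perm_disjoint {n : ℕ} {V : Set ℕ} {W : Fin n → Set ℕ} (hV : V.Finite)
    (hW : ∀ i, (W i).Finite) : ∃ π : Fin n → Equiv.Perm ℕ,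
      (∀ i, ∀ x ∈ W i, π i x ∉ V) ∧
      ∀ i j, i ≠ j → ∀ x ∈ W i, ∀ y ∈ W j, π i x ≠ π j y := by
  obtain ⟨N, hN⟩ := (hV.union (Set.finite_iUnion hW)).bddAbove
  have hlt : ∀ i, ∀ x ∈ W i, x < N + 1 := fun i x hx =>
    Nat.lt_succ_of_le (hN (Or.inr (Set.mem_iUnion_of_mem i hx)))
  -- All variables involved are at most `N`. The `i`-th set is shifted into block `i + 1` of length
  -- `N + 1`; block `0` is reserved for `V`. The shift is not surjective, so only its restriction to
  -- `x < N + 1` is extended to a permutation.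
  have hπ : ∀ i : Fin n, ∃ π : Equiv.Perm ℕ, ∀ x < N + 1, π x = x + (N + 1) * (i + 1) := by
    intro i
    obtain ⟨π, h⟩ := exists_perm_extending (n := N + 1) Fin.valEmbedding
      (Fin.valEmbedding.trans (addRightEmbedding ((N + 1) * (i + 1))))
    exact ⟨π, fun x hx => h ⟨x, hx⟩⟩
  choose π hπ using hπ
  refine ⟨π, fun i x hx hxV => ?_, fun i j hij x hx y hy h => hij ?_⟩
  · have h1 : π i x ≤ N := hN (Or.inl hxV)
    rw [hπ i x (hlt i x hx)] at h1
    nlinarith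
  · rw [hπ i x (hlt i x hx), hπ j y (hlt j y hy)] at h
    -- Division by `N + 1` recovers the block number.
    have h' := congrArg (· / (N + 1)) h
    simp only [Nat.add_mul_div_left _ _ (Nat.succ_pos N), Nat.div_eq_of_lt (hlt i x hx),
      Nat.div_eq_of_lt (hlt j y hy)] at h'
    exact Fin.ext (by omega)

end Permutations

/-! ### Completeness -/

section Completeness

variable {P C : Type*} {ar : P → ℕ} {Pg : Set (Rule ar C)}

theorem Atom.wvars_finite (A : Atom ar (WTerm C)) : A.wvars.Finite := by
  have : A.wvars ⊆ Set.range fun j => match A.args j with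
      | some (.var x) => x
      | _ => 0 := by
    rintro x ⟨j, hj⟩
    exact ⟨j, by simp [hj]⟩
  exact (Set.finite_range _).subset this

theorem Adornment.vars_finite (ρ : Adornment ar C) : ρ.vars.Finite := by
  refine ρ.head.vars_finite.union ?_
  have : {x | ∃ B ∈ ρ.body, x ∈ B.wvars} = ⋃ B ∈ ρ.body, B.wvars := by
    ext x; simp
  rw [this]
  exact ρ.body.finite_toSet.biUnion fun B _ => B.wvars_finite

/-- An adorned fact is not in the database, so its derivation ends with a rule of `S`. The head of
that rule supplies an actual adornment, not just a class, as the construction of a new rule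
requires. -/
theorem Invariant.exists_head_of_derived [Nonempty C] {S : Set (AdRule ar C)}
    (hS : Invariant Pg S) {D : Set (Fact ar C)} {F : Fact ar C} {c : AdornmentClass ar C}
    (h : F.adorn c ∈ derived S (adDatabase D)) :
    ∃ R' ∈ S, ∃ ρ : Adornment ar C, R'.head = ρ.head.adorn ⟦ρ⟧ ∧ ρ.head.pred = F.pred ∧
      F ∈ ρ.eval D ∧ c = ⟦ρ⟧ := by
  obtain ⟨G, -, hG⟩ | ⟨R', hR', ν, -, hF⟩ := derived_cases h
  · exact absurd hG.symm Atom.unadorned_ne_adorn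
  · obtain ⟨ρ, -, hρ⟩ := hS.heads R' hR'
    rw [hρ] at hF
    obtain ⟨rfl, rfl⟩ := Atom.adorn_inj (A := ρ.head.map (Term.ground ν)) hF
    exact ⟨R', hR', ρ, hρ, rfl, (adorn_mem_trueFacts (hS.derived_subset_trueFacts D h)).2, rfl⟩

theorem Adornment.mk_rename (ρ : Adornment ar C) (π : Equiv.Perm ℕ) :
    (⟦ρ.rename π⟧ : AdornmentClass ar C) = ⟦ρ⟧ :=
  (Quotient.sound (⟨π, rfl⟩ : ∃ π' : Equiv.Perm ℕ, ρ.rename π' = ρ.rename π)).symm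

/-- If no rule can be added, then every rule of the program is simulated. -/
theorem Invariant.exists_adorn_derived [Nonempty C] {S : Set (AdRule ar C)}
    (hS : Invariant Pg S) (hfix : ∀ R', Constructs gout Pg S R' → heq R' S)
    {D : Set (Fact ar C)} {R : Rule ar C} (hR : R ∈ Pg) {ν : ℕ → C}
    (hν : ∀ i, ((R.body.get i).pred ∈ idb Pg →
        ∃ c, ((R.body.get i).map (Term.ground ν)).adorn c ∈ derived S (adDatabase D)) ∧
      ((R.body.get i).pred ∉ idb Pg → (R.body.get i).map (Term.ground ν) ∈ D)) :
    ∃ c, (R.head.map (Term.ground ν)).adorn c ∈ derived S (adDatabase D) := by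
  have hρ₀ : ∀ i, ∃ ρ : Adornment ar C, (R.body.get i).pred ∈ idb Pg →
      ρ.head.pred = (R.body.get i).pred ∧
      (∃ Ri ∈ S, Ri.head = ρ.head.adorn ⟦ρ⟧) ∧
      (R.body.get i).map (Term.ground ν) ∈ ρ.eval D ∧
      ((R.body.get i).map (Term.ground ν)).adorn ⟦ρ⟧ ∈ derived S (adDatabase D) := by
    intro i
    by_cases hi : (R.body.get i).pred ∈ idb Pg
    · obtain ⟨c, hc⟩ := (hν i).1 hi
      obtain ⟨Ri, hRi, ρ, h1, h2, h3, rfl⟩ := hS.exists_head_of_derived hc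
      exact ⟨ρ, fun _ => ⟨h2, ⟨Ri, hRi, h1⟩, h3, hc⟩⟩
    -- A dummy value: no adornment is used at EDB positions.
    · exact ⟨⟨R.head, ∅⟩, fun h => absurd h hi⟩
  choose ρ₀ hρ₀ using hρ₀
  obtain ⟨π, hπV, hπW⟩ := exists_perm_disjoint R.vars_finite fun i => (ρ₀ i).vars_finite
  let ρ : Fin R.body.length → Adornment ar C := fun i => (ρ₀ i).rename (π i)
  have hdisj : ∀ i, (R.body.get i).pred ∈ idb Pg → Disjoint (ρ i).vars R.vars ∧
      ∀ j, (R.body.get j).pred ∈ idb Pg → i ≠ j → Disjoint (ρ i).vars (ρ j).vars := by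
    refine fun i _ => ⟨Set.disjoint_left.2 fun x hx => ?_,
      fun j _ hij => Set.disjoint_left.2 fun x hx hx' => ?_⟩
    · obtain ⟨y, hy, rfl⟩ := Adornment.mem_rename_vars.1 hx
      exact hπV i y hy
    · obtain ⟨y, hy, rfl⟩ := Adornment.mem_rename_vars.1 hx
      obtain ⟨z, hz, h⟩ := Adornment.mem_rename_vars.1 hx'
      exact hπW i j hij y hy z hz h.symm
  obtain ⟨τ, hτ, hE, -⟩ := exists_ground_unifier (D := D) (ν := ν) hdisj fun i hi => by
    rw [Adornment.eval_rename]
    exact (hρ₀ i hi).2.2.1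
  obtain ⟨σ, hσ⟩ := exists_isMGU (isUnifier_const hE)
  obtain ⟨ν', hν'⟩ := hσ.exists_ground hE
  have hcon : Constructs gout Pg S (adornedRule gout (idb Pg) R ρ σ) := by
    refine ⟨R, hR, ρ, σ, fun i hi => ⟨(hρ₀ i hi).1, ?_, hdisj i hi⟩, hσ, rfl⟩
    obtain ⟨Ri, hRi, h⟩ := (hρ₀ i hi).2.1
    refine ⟨Ri, hRi, π i, ?_⟩
    rw [Adornment.mk_rename]
    change Ri.head.map _ = _
    rw [h]
    rfl
  -- At a fixpoint a variant of the constructed rule is in `S`, and a variant derives the same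
  -- facts.
  obtain ⟨R'', hR'', π', hπ'⟩ := hfix _ hcon
  refine ⟨⟦gout (inlined (idb Pg) R ρ σ)⟧, derived_of_apply hR'' ?_⟩
  rw [← R''.apply_rename π', hπ', adornedRule_eq_ruleOfClasses]
  have hfun : ∀ x ∈ R.vars, (σ x).ground ν' = ν x := fun x hx => (hν' x).trans (hτ x hx)
  refine ⟨ν', ruleOfClasses_fires.2 fun i => ?_, ?_⟩
  · rw [Atom.map_ground_congr (A := R.body.get i)
      fun x hx => hfun x (R.body_vars_subset i hx)]
    refine ⟨fun hi => ?_, fun hi => derived_of_mem ⟨_, (hν i).2 hi, rfl⟩⟩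
    rw [Adornment.mk_rename]
    exact (hρ₀ i hi).2.2.2
  · rw [ruleOfClasses_head_ground,
      Atom.map_ground_congr (A := R.head) fun x hx => hfun x (R.head_vars_subset hx)]

theorem Invariant.isEquivalent [Nonempty C] (hPg : IsProgram Pg) {S : Set (AdRule ar C)}
    (hS : Invariant Pg S) (hfix : ∀ R', Constructs gout Pg S R' → heq R' S) :
    IsEquivalent Pg S := by
  intro D hD q hq
  refine Set.Subset.antisymm ?_ ?_
  -- The induction also records that derived EDB facts lie in `D`, because rule heads are IDB atoms.
  -- For `D` itself the IDB part is vacuous, since `D` is an EDB.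
  · have key : derived Pg D ⊆ {F | (F.pred ∉ idb Pg → F ∈ D) ∧
        (F.pred ∈ idb Pg → ∃ c, F.adorn c ∈ derived S (adDatabase D))} := by
      refine derived_subset (fun F hF => ⟨fun _ => hF, fun h => absurd h (hD F hF)⟩) ?_
      rintro R hR _ ⟨ν, hν, rfl⟩
      refine ⟨fun h => absurd (hPg.head_idb R hR) h, fun _ =>
        hS.exists_adorn_derived hfix hR fun i => ?_⟩
      exact (hν _ (R.body.get_mem i)).symm
    intro t ht
    obtain ⟨c, hc⟩ := (key ht).2 hq
    exact Set.mem_iUnion.2 ⟨c, hc⟩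
  · intro t ht
    obtain ⟨c, hc⟩ := Set.mem_iUnion.1 ht
    obtain ⟨ρ, rfl⟩ := Quotient.exists_rep c
    exact (adorn_mem_trueFacts (F := ⟨q, t⟩) (hS.derived_subset_trueFacts D hc)).1

end Completeness

/-! ### Termination -/

section Termination

variable {P C : Type*} {ar : P → ℕ} {Pg : Set (Rule ar C)}

theorem finite_atoms {T : Type*} {Q : Set P} {U : Set T} (hQ : Q.Finite) (hU : U.Finite) :
    {A : Atom ar T | A.pred ∈ Q ∧ ∀ j, A.args j ∈ U}.Finite := by
  have : {A : Atom ar T | A.pred ∈ Q ∧ ∀ j, A.args j ∈ U} ⊆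
      ⋃ p ∈ Q, (fun a : Fin (ar p) → T => (⟨p, a⟩ : Atom ar T)) '' {a | ∀ j, a j ∈ U} := by
    rintro ⟨p, a⟩ ⟨hp, ha⟩
    exact Set.mem_biUnion hp ⟨a, ha, rfl⟩
  exact (hQ.biUnion fun p _ => (Set.Finite.pi' fun _ => hU).image _).subset this

/-- The terms built from the first `N` variables and the constants in `K`. -/
def boundedTerms (K : Set C) (N : ℕ) : Set (Term C) :=
  Term.var '' Set.Iio N ∪ Term.const '' K

theorem boundedTerms_finite {K : Set C} (hK : K.Finite) (N : ℕ) : (boundedTerms K N).Finite :=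
  ((Set.finite_Iio N).image _).union (hK.image _)

theorem IsProgram.bodyPreds_finite (hPg : IsProgram Pg) : (bodyPreds Pg).Finite := by
  have : bodyPreds Pg = ⋃ R ∈ Pg, Atom.pred '' {B | B ∈ R.body} := by
    ext p; simp [bodyPreds]
  rw [this]
  exact hPg.finite.biUnion fun R _ => (List.finite_toSet R.body).image _

theorem IsProgram.idb_finite (hPg : IsProgram Pg) : (idb Pg).Finite :=
  (hPg.finite.image fun R => R.head.pred).subset fun _ ⟨R, hR, _, h⟩ => ⟨R, hR, h⟩

theorem IsProgram.constants_finite (hPg : IsProgram Pg) : (constants Pg).Finite := by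
  have : constants Pg ⊆ ⋃ R ∈ Pg, ⋃ A ∈ {A | A ∈ R.head :: R.body},
      Term.const ⁻¹' Set.range A.args := by
    rintro c ⟨R, hR, A, hA, j, hj⟩
    exact Set.mem_biUnion hR (Set.mem_biUnion hA ⟨j, hj⟩)
  refine (hPg.finite.biUnion fun R _ => (List.finite_toSet (R.head :: R.body)).biUnion
    fun A _ => (Set.finite_range A.args).preimage ?_).subset this
  exact fun c _ d _ h => by injection h

/-- Up to renaming of variables, there are only finitely many relaxed adornments. -/
theorem relaxed_classes_finite {I Q : Set P} {K : Set C} (hI : I.Finite) (hQ : Q.Finite)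
    (hK : K.Finite) :
    {c : AdornmentClass ar C | ∃ ρ : Adornment ar C, ρ.Relaxed I Q K ∧ ⟦ρ⟧ = c}.Finite := by
  classical
  -- `N` bounds the arities of the IDB predicates. All variables of a relaxed adornment are head
  -- variables, so they can be renamed to numbers below `N`.
  obtain ⟨N, hN⟩ := (hI.image ar).bddAbove
  let T := boundedTerms K N
  have hT : T.Finite := boundedTerms_finite hK N
  have hT' : (insert none (some '' T) : Set (WTerm C)).Finite := (hT.image _).insert _
  have hheads := finite_atoms (ar := ar) hI hT
  have hbodies := finite_atoms (ar := ar) hQ hT'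
  have hfin := (hheads.prod hbodies.toFinset.powerset.finite_toSet).image
    fun x => (⟦(⟨x.1, x.2⟩ : Adornment ar C)⟧ : AdornmentClass ar C)
  refine hfin.subset ?_
  rintro _ ⟨ρ, hρ, rfl⟩
  obtain ⟨π, hπ⟩ := exists_perm_lt_card fun j => match ρ.head.args j with
    | .var x => x
    -- The value at constants is irrelevant: the bound counts head positions, not variables.
    | .const _ => 0
  rw [Fintype.card_fin] at hπ
  have hρ' := hρ.rename π
  have hvars : ∀ x ∈ (ρ.rename π).head.vars, x < N := by
    intro x hx
    obtain ⟨y, ⟨j, hj⟩, rfl⟩ := Atom.mem_rename_vars.1 hx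
    have := hπ j
    rw [hj] at this
    exact this.trans_le (hN ⟨_, hρ.head_idb, rfl⟩)
  refine ⟨((ρ.rename π).head, (ρ.rename π).body), ⟨⟨hρ'.head_idb, fun j => ?_⟩, ?_⟩,
    ρ.mk_rename π⟩
  · cases h : (ρ.rename π).head.args j with
    | var x => exact Or.inl ⟨x, hvars x ⟨j, h⟩, rfl⟩
    | const c => exact Or.inr ⟨c, hρ'.head_const j c h, rfl⟩
  · rw [Finset.mem_coe, Finset.mem_powerset]
    intro B hB
    rw [Set.Finite.mem_toFinset]
    refine ⟨hρ'.body_pred B hB, fun j => ?_⟩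
    obtain h | ⟨x, h⟩ := hρ'.wellFormed.var_or_wild B hB j
    · exact Or.inl h
    · exact Or.inr ⟨.var x, Or.inl ⟨x, hvars x (hρ'.body_vars B hB ⟨j, h⟩), rfl⟩, h.symm⟩

theorem ruleOfClasses_congr {I : Set P} {R : Rule ar C} {c : AdornmentClass ar C}
    {cs cs' : Fin R.body.length → AdornmentClass ar C} {σ σ' : Subst C}
    (hcs : ∀ i, (R.body.get i).pred ∈ I → cs i = cs' i) (hσ : ∀ x ∈ R.vars, σ x = σ' x) :
    ruleOfClasses I R c cs σ = ruleOfClasses I R c cs' σ' := by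
  unfold ruleOfClasses
  rw [Atom.map_subst_congr fun x hx => hσ x (R.head_vars_subset hx)]
  congr 2
  funext i
  rw [Atom.map_subst_congr fun x hx => hσ x (R.body_vars_subset i hx)]
  split_ifs with hi
  · rw [hcs i hi]
  · rfl

theorem ruleOfClasses_rename {I : Set P} {R : Rule ar C} {c : AdornmentClass ar C}
    {cs : Fin R.body.length → AdornmentClass ar C} {σ : Subst C} (π : Equiv.Perm ℕ) :
    (ruleOfClasses I R c cs σ).rename π =
      ruleOfClasses I R c cs fun x => (σ x).subst fun y => .var (π y) := by
  have key : ∀ A : Atom ar (Term C),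
      (A.map (Term.subst σ)).map (Term.subst fun y => .var (π y)) =
        A.map (Term.subst fun x => (σ x).subst fun y => .var (π y)) := fun A => by
    rw [Atom.map_map]
    exact Atom.map_congr fun j => Term.subst_subst _ _ _
  unfold ruleOfClasses Rule.rename Rule.subst
  simp only [← key, List.map_ofFn]
  congr 2
  funext i
  simp only [Function.comp_apply]
  split_ifs <;> rfl

/-- Up to renaming of variables, there are only finitely many rules that can be constructed. -/
theorem exists_finite_representatives (hPg : IsProgram Pg) :
    ∃ X : Set (AdRule ar C), X.Finite ∧ ∀ S, Invariant Pg S → ∀ R', Constructs gout Pg S R' →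
      ∃ π : Equiv.Perm ℕ, R'.rename π ∈ X := by
  classical
  let Cl := {c : AdornmentClass ar C | ∃ ρ : Adornment ar C,
    ρ.Relaxed (idb Pg) (bodyPreds Pg) (constants Pg) ∧ ⟦ρ⟧ = c}
  have hCl : Cl.Finite :=
    relaxed_classes_finite hPg.idb_finite hPg.bodyPreds_finite hPg.constants_finite
  -- Each `σ x` contains at most one variable, so the values of `σ` on the variables of `R` involve
  -- at most `R.vars.ncard` variables.
  let T : Rule ar C → Set (Term C) := fun R => boundedTerms (constants Pg) R.vars.ncard
  let ext : (R : Rule ar C) → (R.vars → Term C) → Subst C := fun R f x =>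
    if h : x ∈ R.vars then f ⟨x, h⟩ else .var x
  refine ⟨⋃ R ∈ Pg, (fun y : AdornmentClass ar C × (Fin R.body.length → AdornmentClass ar C) ×
      (R.vars → Term C) => ruleOfClasses (idb Pg) R y.1 y.2.1 (ext R y.2.2)) ''
      (Cl ×ˢ {cs | ∀ i, cs i ∈ Cl} ×ˢ {f | ∀ x, f x ∈ T R}), ?_, ?_⟩
  · refine hPg.finite.biUnion fun R _ => Set.Finite.image _ ?_
    have := R.vars_finite.to_subtype
    exact hCl.prod ((Set.Finite.pi' fun _ => hCl).prod
      (Set.Finite.pi' fun _ => boundedTerms_finite hPg.constants_finite _))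
  · rintro S hS _ ⟨R, hR, ρ, σ, hρ, hσ, rfl⟩
    have hrel := hS.heads.choice hρ
    have hhead := relaxed_gout_inlined hPg hR hrel hσ
    have := R.vars_finite.fintype
    obtain ⟨π, hπ⟩ := exists_perm_lt_card fun x : R.vars => match σ x with
      | .var y => y
      | .const _ => 0
    rw [← Nat.card_eq_fintype_card, Nat.card_coe_set_eq] at hπ
    refine ⟨π, Set.mem_biUnion hR ⟨(⟦gout (inlined (idb Pg) R ρ σ)⟧,
      -- At EDB positions the class does not affect the rule; the class of the head is a filler that
      -- lies in `Cl`.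
      fun i => if (R.body.get i).pred ∈ idb Pg then ⟦ρ i⟧ else
        ⟦gout (inlined (idb Pg) R ρ σ)⟧,
      fun x => (σ x).subst fun y => .var (π y)), ⟨⟨_, hhead, rfl⟩, fun i => ?_, fun x => ?_⟩,
      ?_⟩⟩
    · by_cases hi : (R.body.get i).pred ∈ idb Pg
      · simp only [hi, if_true]
        exact ⟨_, hrel i hi, rfl⟩
      · simp only [hi, if_false]
        exact ⟨_, hhead, rfl⟩
    · have hx := hπ x
      cases h : σ x with
      | var y =>
        rw [h] at hx
        exact Or.inl ⟨π y, hx, by simp [h, Term.subst]⟩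
      | const c =>
        exact Or.inr ⟨c, IsMGU.const_mem_constants hR hrel hσ h, by simp [h, Term.subst]⟩
    · rw [adornedRule_eq_ruleOfClasses, ruleOfClasses_rename]
      refine ruleOfClasses_congr (fun i hi => if_pos hi) fun x hx => ?_
      simp only [ext, dif_pos hx]

theorem terminates (hPg : IsProgram Pg) : Terminates gout heq Pg := by
  rintro ⟨S, h0, hS⟩
  have hinv : ∀ n, Invariant Pg (S n) := fun n => by
    induction n with
    | zero => rw [h0]; exact Invariant.empty
    | succ n ih => exact ih.step hPg (hS n)
  have hmono : Monotone S := monotone_nat_of_le_succ fun n => by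
    obtain ⟨R', -, -, h⟩ := hS n
    rw [h]
    exact Set.subset_insert _ _
  obtain ⟨X, hX, hrep⟩ := exists_finite_representatives hPg
  choose R hR hnew hsucc using hS
  choose π hπ using fun n => hrep (S n) (hinv n) (R n) (hR n)
  have := hX.to_subtype
  -- Two additions share a representative in the finite set `X`. The earlier rule is still present
  -- when the later one is added, so `heq` would have rejected the later one.
  obtain ⟨m, n, hmn, h⟩ := Finite.exists_ne_map_eq_of_infinite
    fun n => (⟨_, hπ n⟩ : X)
  have h : (R m).rename (π m) = (R n).rename (π n) := congrArg Subtype.val h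
  have key : ∀ m n, m < n → (R m).rename (π m) ≠ (R n).rename (π n) := by
    intro m n hmn h
    refine hnew n ⟨R m, hmono hmn (by rw [hsucc m]; exact Set.mem_insert _ _),
      (π n)⁻¹ * π m, ?_⟩
    rw [← Rule.rename_rename, h, Rule.rename_rename, inv_mul_cancel, Rule.rename_one]
  rcases hmn.lt_or_gt with hlt | hlt
  · exact key m n hlt h
  · exact key n m hlt h.symm

theorem Terminates.exists_isOutput {g : Adornment ar C → Adornment ar C}
    {h : AdRule ar C → Set (AdRule ar C) → Prop} (hT : Terminates g h Pg) :
    ∃ Pg', IsOutput g h Pg Pg' := by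
  by_contra! hno
  have hnext : ∀ S : {S // Relation.ReflTransGen (Step g h Pg) ∅ S},
      ∃ S' : {S // Relation.ReflTransGen (Step g h Pg) ∅ S}, Step g h Pg S.1 S'.1 := by
    rintro ⟨S, hS⟩
    have : ¬ ∀ R', Constructs g Pg S R' → h R' S := fun hfix => hno S ⟨hS, hfix⟩
    push Not at this
    obtain ⟨R', hR', hnew⟩ := this
    have hstep : Step g h Pg S (insert R' S) := ⟨R', hR', hnew, rfl⟩
    exact ⟨⟨_, hS.tail hstep⟩, hstep⟩
  choose next hnext using hnext
  refine hT ⟨fun n => (next^[n] ⟨∅, .refl⟩).1, rfl, fun n => ?_⟩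
  simp only [Function.iterate_succ_apply']
  exact hnext _

end Termination

end Datalog

theorem mainTheorem1 {P C : Type*} [Nonempty C] (ar : P → ℕ) (Pg : Set (Datalog.Rule ar C))
    (hPg : Datalog.IsProgram Pg) :
    Datalog.Terminates Datalog.gout Datalog.heq Pg ∧
    (∃ Pg', Datalog.IsOutput Datalog.gout Datalog.heq Pg Pg') ∧
    ∀ Pg', Datalog.IsOutput Datalog.gout Datalog.heq Pg Pg' →
      Datalog.IsEDBBounded (Datalog.idb Pg) Pg' ∧ Datalog.IsEquivalent Pg Pg' := by
  have hT := Datalog.terminates hPg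
  refine ⟨hT, hT.exists_isOutput, fun Pg' h => ?_⟩
  have hinv := Datalog.Invariant.of_reachable hPg h.1
  exact ⟨hinv.isEDBBounded, hinv.isEquivalent hPg h.2⟩
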